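/- Let $\xi$ be a random element with law $\nu$, and consider the quadratic losses $f_\xi(x)=\tfrac12x^\top A_\xi x-b_\xi^\top x+c$ on $\mathbb R^d$, with $A_\xi$ a random symmetric $d\times d$ matrix, $b_\xi$ a random vector and $c$ a constant. Let $x^*$ minimize $\mathbb E[f_\xi(x)]$ and let $\Sigma=\mathbb E[A_\xi]$ have eigenvalues $\kappa_1\le\dots\le\kappa_d$ with $\mu:=\kappa_1>0$ and $L:=\kappa_d$. Assume $\mathbb E\|\nabla f_\xi(x^*)\|^2\le\sigma^2$ with $\sigma>0$, and $\mathbb E[L_\xi^2]\le L_f^2$, where $L_\xi=\sup_x\|\nabla f_\xi(x)-\nabla f_\xi(x^*)\|/\|x-x^*\|$. Mini-batch SGDM with momentum weight $\gamma$, learning rate $\alpha$ and batch size $B$ is the recursion $m_1=0$, $x_1$ given (deterministic), and for $t\ge1$ $$m_{t+1}=\gamma m_t+(1-\gamma)\nabla g_{\eta_t}(x_t),\qquad x_{t+1}=x_t-\alpha m_{t+1},\qquad g_{\eta_t}(x)=\frac1B\sum_{i=1}^Bf_{\xi_{ti}}(x),$$ with $\xi_{ti}$ i.i.d. copies of $\xi$.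 Put $$\Delta=\min_k\big|(\gamma+1-\alpha(1-\gamma)\kappa_k)^2-4\gamma\big|,\qquad M=\frac{4}{\sqrt\Delta}\big(2(1-\gamma)(1+\alpha L+L)+3\alpha\gamma\big),$$ and let $\lambda$ be the spectral radius of $\Gamma=\begin{pmatrix}\gamma I&(1-\gamma)\Sigma\\-\alpha\gamma I&I-\alpha(1-\gamma)\Sigma\end{pmatrix}$. Fix the distribution of $\xi$, $x_1$, $\sigma$, $L_f$ and $\delta\in(0,1]$. Consider a sequence of runs with parameters $(\gamma,\alpha,B,n,n_0)=(\gamma_k,\alpha_k,B_k,n_k,n_{0,k})$, $k\in\mathbb N$, such that for every $k$: $\gamma\in[0,1)$, $\alpha>0$, $B\ge1$, $\alpha L<2(1+\gamma)/(1-\gamma)$, $\Delta>0$, $16M^2\alpha^2L_f^2\le B\delta\lambda^{2(1-\delta)}(1-\lambda)$, $\lambda^{2n_0}\le B^{-1}(1-\lambda)$ and $n\ge2n_0$. Assume also that $M$ and $\alpha/(1-\lambda)$ stay bounded along the sequence (this is automatic if $\gamma$ is fixed and $\alpha$ is either constant or tends to $0$). If $\alpha n\to\infty$ and $B/\alpha\to\infty$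 as $k\to\infty$, then $$\frac{\sqrt B}{\sigma}\,\frac{\sum_{t=n_0+1}^n(x_t-x^*)}{\sqrt{n-n_0}}\Rightarrow\mathcal N\big(0,\Sigma^{-1}\Omega\Sigma^{-1}\big),\qquad \Omega=\frac1{\sigma^2}\mathbb E\big[(A_\xi x^*-b_\xi)(A_\xi x^*-b_\xi)^\top\big].$$ -/

import Mathlib

open MeasureTheory ProbabilityTheory Filter Topology Matrix WithLp
open scoped ENNReal

noncomputable section

namespace AvgSGDM

/-! ### Quadratic stochastic losses -/

/-- The quadratic loss `x ↦ ½ xᵀ A x - bᵀ x + c`. -/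
def quadLoss {d : ℕ} (A : Matrix (Fin d) (Fin d) ℝ) (b : EuclideanSpace ℝ (Fin d)) (c : ℝ)
    (x : EuclideanSpace ℝ (Fin d)) : ℝ :=
  (1 / 2) * (x.ofLp ⬝ᵥ A *ᵥ x.ofLp) - b.ofLp ⬝ᵥ x.ofLp + c

/-- The population loss `x ↦ E[f_ξ(x)]`, where `ξ` has law `ν`. -/
def popLoss {d : ℕ} {E : Type*} [MeasurableSpace E] (ν : Measure E)
    (f : E → EuclideanSpace ℝ (Fin d) → ℝ) (x : EuclideanSpace ℝ (Fin d)) : ℝ :=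
  ∫ e, f e x ∂ν

/-- The Hessian `Σ = E[A_ξ]` of the population loss. -/
def hessian {d : ℕ} {E : Type*} [MeasurableSpace E] (ν : Measure E)
    (A : E → Matrix (Fin d) (Fin d) ℝ) : Matrix (Fin d) (Fin d) ℝ :=
  Matrix.of fun i j => ∫ e, A e i j ∂ν

/-- `L_ξ = sup_x ‖∇f_ξ(x) - ∇f_ξ(x*)‖ / ‖x - x*‖`, as an extended nonnegative number
(the term `x = x*` is `0`). -/
def gradLip {d : ℕ} (f : EuclideanSpace ℝ (Fin d) → ℝ) (xs : EuclideanSpace ℝ (Fin d)) : ℝ≥0∞ :=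
  ⨆ x : EuclideanSpace ℝ (Fin d), ‖gradient f x - gradient f xs‖ₑ / ‖x - xs‖ₑ

/-- `Ω = σ⁻² E[(A_ξ x* - b_ξ)(A_ξ x* - b_ξ)ᵀ]`. -/
def gram {d : ℕ} {E : Type*} [MeasurableSpace E] (ν : Measure E)
    (A : E → Matrix (Fin d) (Fin d) ℝ) (b : E → EuclideanSpace ℝ (Fin d))
    (xs : EuclideanSpace ℝ (Fin d)) (σ : ℝ) : Matrix (Fin d) (Fin d) ℝ :=
  Matrix.of fun i j =>
    (1 / σ ^ 2) * ∫ e, ((A e *ᵥ xs.ofLp) i - b e i) * ((A e *ᵥ xs.ofLp) j - b e j) ∂ν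

/-! ### Mini-batch SGD with momentum -/

/-- The mini-batch loss `g_η(x) = B⁻¹ ∑ᵢ f_{ηᵢ}(x)`. -/
def batchLoss {d : ℕ} {E : Type*} {B : ℕ} (f : E → EuclideanSpace ℝ (Fin d) → ℝ)
    (η : Fin B → E) (x : EuclideanSpace ℝ (Fin d)) : ℝ :=
  (1 / (B : ℝ)) * ∑ i, f (η i) x

/-- The pair `(m_t, x_t)` of mini-batch SGDM with momentum weight `γ`, learning rate `α` and
batches `η_t`, `t ≥ 1`. Time starts at `t = 1` with `m_1 = 0` and `x_1` given (the value at `t = 0`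
is a placeholder and is not used), and for `t ≥ 1`
`m_{t+1} = γ m_t + (1 - γ) ∇g_{η_t}(x_t)`, `x_{t+1} = x_t - α m_{t+1}`. -/
def sgdm {d : ℕ} {E : Type*} {B : ℕ} (f : E → EuclideanSpace ℝ (Fin d) → ℝ) (γ α : ℝ)
    (η : ℕ → Fin B → E) (x₁ : EuclideanSpace ℝ (Fin d)) :
    ℕ → EuclideanSpace ℝ (Fin d) × EuclideanSpace ℝ (Fin d)
  | 0 => (0, x₁)
  | 1 => (0, x₁)
  | t + 2 =>
    let s := sgdm f γ α η x₁ (t + 1)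
    let m := γ • s.1 + (1 - γ) • gradient (batchLoss f (η (t + 1))) s.2
    (m, s.2 - α • m)

/-! ### The constants `μ, L, Δ, M, λ` -/

/-- The smallest eigenvalue `μ = κ_1` of a symmetric matrix. -/
def minEig {d : ℕ} (S : Matrix (Fin d) (Fin d) ℝ) : ℝ := sInf (spectrum ℝ S)

/-- The largest eigenvalue `L = κ_d` of a symmetric matrix. -/
def maxEig {d : ℕ} (S : Matrix (Fin d) (Fin d) ℝ) : ℝ := sSup (spectrum ℝ S)

/-- `Δ = min_k |(γ + 1 - α (1 - γ) κ_k)² - 4 γ|`, `κ_k` ranging over the eigenvalues of `S`. -/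
def minDiscr {d : ℕ} (S : Matrix (Fin d) (Fin d) ℝ) (γ α : ℝ) : ℝ :=
  sInf ((fun κ : ℝ => |(γ + 1 - α * (1 - γ) * κ) ^ 2 - 4 * γ|) '' spectrum ℝ S)

/-- `M = 4 Δ^{-1/2} (2 (1 - γ) (1 + α L + L) + 3 α γ)`. -/
def constM {d : ℕ} (S : Matrix (Fin d) (Fin d) ℝ) (γ α : ℝ) : ℝ :=
  4 / Real.sqrt (minDiscr S γ α) *
    (2 * (1 - γ) * (1 + α * maxEig S + maxEig S) + 3 * α * γ)

/-- The block matrix `Γ = [[γ I, (1 - γ) S], [-α γ I, I - α (1 - γ) S]]`. -/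
def momentumMatrix {d : ℕ} (S : Matrix (Fin d) (Fin d) ℝ) (γ α : ℝ) :
    Matrix (Fin d ⊕ Fin d) (Fin d ⊕ Fin d) ℝ :=
  Matrix.fromBlocks (γ • 1) ((1 - γ) • S) (-(α * γ) • 1) (1 - (α * (1 - γ)) • S)

/-- The spectral radius `λ` of `Γ`: the largest modulus of its complex eigenvalues. -/
def specRad {d : ℕ} (S : Matrix (Fin d) (Fin d) ℝ) (γ α : ℝ) : ℝ :=
  (spectralRadius ℂ ((momentumMatrix S γ α).map (algebraMap ℝ ℂ))).toReal

end AvgSGDM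

end

/-!
Write `y_t = x_t - x*` and `m_t` for the momentum. The gradient of the mini-batch loss is
`Σ y_t + w_t`, where `w_t = D_t y_t + u_t`, `D_t` is the deviation of the averaged Hessian of the
batch from `Σ`, and `u_t` is the average of `A_ξ x* - b_ξ` over the batch. Both `D_t` and `u_t` are
centered (`integral_gradNoise_eq_zero`) and independent of the past, so the `w_t` are orthogonal.

Summing the recursion over the window `n₀ < t ≤ n` gives the exact identity
(`IsMomentum.sum_eq`)
`Σ ∑ y_t = -∑ u_t - ∑ D_t y_t + (boundary terms in y / α and γ m / (1 - γ))`.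
The first sum consists of `(n - n₀) B` independent terms and produces the Gaussian limit; the rest
must be shown to vanish in `L²` after multiplication by `√(B / (n - n₀))`. By orthogonality this
follows from `E‖y_t‖² = O(α / B)` and `E‖m_t‖² = O((1 - γ)² / (α B))` for `t > n₀`
(`IsMomentum.integral_norm_sq_le_of_burnIn`): the normalized remainder has mean square
`O(α / B + 1 / (α (n - n₀)))` (`IsMomentum.integral_remainder_le`).

For the moment bounds, the recursion is diagonalized along the eigenvectors of `Σ`. For an
eigenvalue `κ` it is a scalar second-order recursion, solved by the impulse response
`h_t = (r^t - s^t) / (r - s)`, where `r, s` are the roots of `z² - (γ + 1 - α (1 - γ) κ) z + γ`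
(`momentum_solution`). They are eigenvalues of `Γ`, so `|r|, |s| ≤ λ`, while `|r - s|² ≥ Δ`; hence
`4 (1 - γ) |h_t| ≤ M λ^t`, and the increments of `h` are of order `λ^t` as well
(`impulse_bounds`). Boundedness of `α / (1 - λ)` makes `λ < 1`, and `1 - λ ≤ 2 α κ`. Inserted in the
solution formula, these bounds give a renewal inequality for `E‖y_t‖²`, because `E‖D_t y_t‖²` is at
most `L_f² E‖y_t‖² / B`; it is solved by `renewal_le`. The rate condition says that the feedback
through `D_t` is at most `1 - λ`, and the condition on `λ^{2 n₀}` that the initial error has decayed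
to the stationary level when the window begins.

Convergence in distribution is tested on characteristic functions through Lévy's theorem: the one
of the normalized average at `v` differs from that of the i.i.d. sum of `-σ⁻¹ ⟪A_ξ x* - b_ξ, Σ⁻¹ v⟫`
by at most the `L²` norm of the remainder times `‖Σ⁻¹ v‖` (`norm_charFun_scaledAverage_sub_le`). The
latter converges by the classical central limit theorem (`tendsto_charFun_pow`), and its limit is
the characteristic function of `N(0, Σ⁻¹ Ω Σ⁻¹)` (`charFun_limit`).
-/

namespace AvgSGDM

/-! ### The impulse response of a damped scalar recursion -/

/-- The impulse response `h` of the second order recursion with characteristic polynomial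
`r² - p r + γ`: `h 0 = 0`, `h 1 = 1` and `h (t + 2) = p h (t + 1) - γ h t`. -/
noncomputable def impulse (p γ : ℝ) : ℕ → ℝ
  | 0 => 0
  | 1 => 1
  | t + 2 => p * impulse p γ (t + 1) - γ * impulse p γ t

lemma exists_roots (p γ : ℝ) : ∃ r s : ℂ, r + s = p ∧ r * s = γ := by
  obtain ⟨z, hz⟩ := IsAlgClosed.exists_pow_nat_eq ((p : ℂ) ^ 2 - 4 * γ) (n := 2) two_pos
  refine ⟨(p + z) / 2, (p - z) / 2, by ring, ?_⟩
  linear_combination (-1 / 4) * hz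

lemma norm_sub_of_roots {p γ : ℝ} {r s : ℂ} (h₁ : r + s = p) (h₂ : r * s = γ) :
    ‖r - s‖ = √|p ^ 2 - 4 * γ| := by
  have h : (r - s) ^ 2 = ((p ^ 2 - 4 * γ : ℝ) : ℂ) := by
    push_cast
    linear_combination (r + s + p) * h₁ - 4 * h₂
  rw [← Real.norm_eq_abs, ← Complex.norm_real, ← h, norm_pow, Real.sqrt_sq (norm_nonneg _)]

lemma impulse_mul_sub {p γ : ℝ} {r s : ℂ} (h₁ : r + s = p) (h₂ : r * s = γ) :
    ∀ t, (impulse p γ t : ℂ) * (r - s) = r ^ t - s ^ t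
  | 0 => by simp [impulse]
  | 1 => by simp [impulse]
  | t + 2 => by
    have e₁ := impulse_mul_sub h₁ h₂ t
    have e₂ := impulse_mul_sub h₁ h₂ (t + 1)
    simp only [impulse]
    push_cast
    rw [← h₁, ← h₂]
    linear_combination (r + s) * e₂ - r * s * e₁

lemma sqrt_discr_mul_abs_impulse_le {p γ l : ℝ} {r s : ℂ} (h₁ : r + s = p) (h₂ : r * s = γ)
    (hr : ‖r‖ ≤ l) (hs : ‖s‖ ≤ l) (t : ℕ) :
    √|p ^ 2 - 4 * γ| * |impulse p γ t| ≤ 2 * l ^ t := by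
  rw [← norm_sub_of_roots h₁ h₂, ← Real.norm_eq_abs, ← Complex.norm_real, mul_comm, ← norm_mul,
    impulse_mul_sub h₁ h₂]
  refine (norm_sub_le _ _).trans ?_
  rw [norm_pow, norm_pow, two_mul]
  gcongr

lemma sqrt_discr_mul_abs_impulse_sub_le {p γ l ρ : ℝ} {r s : ℂ} (h₁ : r + s = p) (h₂ : r * s = γ)
    (hr : ‖r‖ ≤ l) (hs : ‖s‖ ≤ l) (hr' : ‖r - 1‖ ≤ ρ) (hs' : ‖s - 1‖ ≤ ρ) (t : ℕ) :
    √|p ^ 2 - 4 * γ| * |impulse p γ (t + 1) - impulse p γ t| ≤ 2 * ρ * l ^ t := by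
  have e : ((impulse p γ (t + 1) - impulse p γ t : ℝ) : ℂ) * (r - s) =
      (r - 1) * r ^ t - (s - 1) * s ^ t := by
    push_cast
    linear_combination impulse_mul_sub h₁ h₂ (t + 1) - impulse_mul_sub h₁ h₂ t
  rw [← norm_sub_of_roots h₁ h₂, ← Real.norm_eq_abs, ← Complex.norm_real, mul_comm, ← norm_mul, e]
  refine (norm_sub_le _ _).trans ?_
  have hρ : 0 ≤ ρ := (norm_nonneg _).trans hr'
  rw [norm_mul, norm_mul, norm_pow, norm_pow, two_mul, add_mul]
  gcongr

/-- Variation of constants: the solution of the scalar momentum recursion forced by `w`. -/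
lemma momentum_solution {γ α κ : ℝ} {y m w : ℕ → ℝ} (h₀ : m 0 = 0)
    (hm : ∀ t, m (t + 1) = γ * m t + (1 - γ) * (κ * y t + w t))
    (hy : ∀ t, y (t + 1) = y t - α * m (t + 1)) {h : ℕ → ℝ}
    (hh : h = impulse (γ + 1 - α * (1 - γ) * κ) γ) (t : ℕ) :
    y t = (h (t + 1) - γ * h t) * y 0
        + ∑ s ∈ Finset.range t, (-(α * (1 - γ)) * h (t - s)) * w s ∧
      m t = (1 - γ) * κ * h t * y 0
        + ∑ s ∈ Finset.range t, ((1 - γ) * (h (t - s) - h (t - s - 1))) * w s := by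
  have hrec : ∀ t, h (t + 2) = (γ + 1 - α * (1 - γ) * κ) * h (t + 1) - γ * h t := by
    intro t; rw [hh]; rfl
  have h0 : h 0 = 0 := by rw [hh]; rfl
  have h1 : h 1 = 1 := by rw [hh]; rfl
  -- the two convolutions of `w` with the impulse response satisfy a linear system
  set U : ℕ → ℝ := fun t => ∑ s ∈ Finset.range t, h (t - s) * w s with hU
  set V : ℕ → ℝ := fun t => ∑ s ∈ Finset.range t, h (t - s - 1) * w s with hV
  have eU : ∀ t, U (t + 1) = (γ + 1 - α * (1 - γ) * κ) * U t - γ * V t + w t := by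
    intro t
    simp only [hU, hV]
    rw [Finset.sum_range_succ, Finset.mul_sum, Finset.mul_sum, ← Finset.sum_sub_distrib]
    congr 1
    · refine Finset.sum_congr rfl fun s hs => ?_
      obtain ⟨k, rfl⟩ : ∃ k, t = s + k + 1 :=
        ⟨t - s - 1, by have := Finset.mem_range.1 hs; omega⟩
      have e₁ : s + k + 1 + 1 - s = k + 2 := by omega
      have e₂ : s + k + 1 - s = k + 1 := by omega
      rw [e₁, e₂, hrec]
      simp only [Nat.add_sub_cancel]
      ring
    · simp [h1]
  have eV : ∀ t, V (t + 1) = U t := by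
    intro t
    simp only [hU, hV]
    rw [Finset.sum_range_succ]
    simp only [Nat.add_sub_cancel_left, Nat.sub_self, h0, zero_mul, add_zero]
    refine Finset.sum_congr rfl fun s hs => ?_
    congr 2
    omega
  have key : ∀ t, y t = (h (t + 1) - γ * h t) * y 0 - α * (1 - γ) * U t ∧
      m t = (1 - γ) * (κ * h t * y 0 + U t - V t) := by
    intro t
    induction t with
    | zero => simp [hU, hV, h0, h1, h₀]
    | succ t ih =>
      have em : m (t + 1) = (1 - γ) * (κ * h (t + 1) * y 0 + U (t + 1) - V (t + 1)) := by
        rw [hm, ih.1, ih.2, eU, eV]; ring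
      refine ⟨?_, em⟩
      rw [hy, em, ih.1, eU, eV, hrec]; ring
  refine ⟨(key t).1.trans ?_, (key t).2.trans ?_⟩
  · simp only [hU]
    rw [sub_eq_add_neg, ← neg_mul, Finset.mul_sum]
    simp only [mul_assoc]
  · simp only [hU, hV]
    rw [add_sub_assoc, ← Finset.sum_sub_distrib, mul_add, Finset.mul_sum]
    congr 1
    · ring
    · exact Finset.sum_congr rfl fun s _ => by ring

/-! ### A discrete Grönwall inequality -/

/-- A renewal inequality with geometric kernel. The feedback `q ρ` only worsens the rate `l²` to
`l² (1 + q ρ)`. -/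
lemma renewal_le {a : ℕ → ℝ} {l K q ρ v : ℝ} (hl₀ : 0 ≤ l) (hl₁ : l < 1)
    (hq : 0 ≤ q) (hρ : 0 ≤ ρ) (hv : 0 ≤ v) (hε : q * ρ ≤ 1 - l)
    (h : ∀ t, a t ≤ K * l ^ (2 * t)
      + ∑ s ∈ Finset.range t, q * l ^ (2 * (t - s)) * (ρ * a s + v)) (t : ℕ) :
    a t ≤ K * (l ^ 2 * (1 + q * ρ)) ^ t + q * v / (1 - l) := by
  set e : ℕ → ℝ := fun t => K * l ^ (2 * t)
      + ∑ s ∈ Finset.range t, q * l ^ (2 * (t - s)) * (ρ * a s + v) with he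
  have hl : 0 < 1 - l := by linarith
  have erec : ∀ t, e (t + 1) = l ^ 2 * (e t + q * (ρ * a t + v)) := by
    intro t
    simp only [he]
    rw [Finset.sum_range_succ, mul_add (l ^ 2), mul_add (l ^ 2), Finset.mul_sum, ← add_assoc]
    refine congrArg₂ (· + ·) (congrArg₂ (· + ·) ?_ ?_) ?_
    · ring
    · refine Finset.sum_congr rfl fun s hs => ?_
      have : 2 * (t + 1 - s) = 2 * (t - s) + 2 := by have := Finset.mem_range.1 hs; omega
      rw [this, pow_add]; ring
    · simp only [Nat.add_sub_cancel_left]; ring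
  have key : ∀ t, e t ≤ K * (l ^ 2 * (1 + q * ρ)) ^ t + q * v / (1 - l) := by
    intro t
    induction t with
    | zero => simp only [he]; simp; positivity
    | succ t ih =>
      have h1 : e (t + 1) ≤ (l ^ 2 * (1 + q * ρ)) * e t + l ^ 2 * (q * v) := by
        rw [erec]
        have := mul_le_mul_of_nonneg_left (h t) (by positivity : 0 ≤ l ^ 2 * (q * ρ))
        nlinarith [this]
      have h2 := mul_le_mul_of_nonneg_left ih
        (by positivity : 0 ≤ l ^ 2 * (1 + q * ρ))
      have h3 : l ^ 2 * (1 + q * ρ) + l ^ 2 * (1 - l) ≤ 1 := by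
        have : l ^ 2 * (1 + q * ρ) ≤ l ^ 2 * (1 + (1 - l)) := by gcongr
        nlinarith [mul_nonneg (sq_nonneg (1 - l)) (by linarith : 0 ≤ 1 + 2 * l)]
      have h4 : q * v * (l ^ 2 * (1 + q * ρ)) / (1 - l) + l ^ 2 * (q * v) ≤ q * v / (1 - l) := by
        rw [div_add' _ _ _ hl.ne', div_le_div_iff_of_pos_right hl]
        have := mul_le_mul_of_nonneg_left h3 (mul_nonneg hq hv)
        nlinarith [this]
      calc e (t + 1) ≤ _ := h1
        _ ≤ l ^ 2 * (1 + q * ρ) * (K * (l ^ 2 * (1 + q * ρ)) ^ t + q * v / (1 - l))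
            + l ^ 2 * (q * v) := by linarith
        _ = K * (l ^ 2 * (1 + q * ρ)) ^ (t + 1)
            + (q * v * (l ^ 2 * (1 + q * ρ)) / (1 - l) + l ^ 2 * (q * v)) := by
          rw [pow_succ]; ring
        _ ≤ _ := by linarith
  exact (h t).trans (key t)

/-- If a burn-in of length `n` brings `l ^ (2 n)` below `(1 - l) / B`, the rate
`l² (1 + ε)` does so as well up to a constant, since `ε` is of order `(1 - l)² / B`. -/
lemma pow_perturbed_le {l ε k b : ℝ} {n : ℕ} (hl₀ : 0 < l) (hl₁ : l < 1) (hε₀ : 0 ≤ ε)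
    (hε₁ : ε ≤ 1 - l) (hb : 1 ≤ b) (hn : l ^ (2 * n) ≤ b⁻¹ * (1 - l))
    (hk : ε * b ≤ k * (1 - l) ^ 2) :
    (l ^ 2 * (1 + ε)) ^ n ≤ Real.exp (k / 2) * (b⁻¹ * (1 - l)) := by
  have hl : 0 < 1 - l := by linarith
  have hb0 : 0 < b := by linarith
  have hz : 0 < b⁻¹ * (1 - l) := by positivity
  set ℓ := -Real.log l with hℓ
  set z := b⁻¹ * (1 - l) with hzdef
  have h1 : 1 - l ≤ ℓ := by have := Real.log_le_sub_one_of_pos hl₀; linarith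
  have hℓ0 : 0 < ℓ := by linarith
  have h2 : -Real.log z ≤ n * (2 * ℓ) := by
    have := Real.log_le_log (by positivity) hn
    rw [Real.log_pow] at this
    push_cast at this
    rw [hℓ]; linarith
  have h3 : -Real.log z ≤ z⁻¹ := by
    rw [← Real.log_inv]
    have := Real.log_le_sub_one_of_pos (inv_pos.2 hz)
    linarith
  have h4 : Real.log (1 + ε) ≤ ε := by
    have := Real.log_le_sub_one_of_pos (by linarith : 0 < 1 + ε); linarith
  have h5 : Real.log ((l ^ 2 * (1 + ε)) ^ n) ≤ k / 2 + Real.log z := by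
    rw [Real.log_pow, Real.log_mul (by positivity) (by positivity), Real.log_pow]
    push_cast
    have e1 : (n : ℝ) * (2 * Real.log l + Real.log (1 + ε)) ≤ n * (ε - 2 * ℓ) := by
      gcongr; rw [hℓ]; linarith
    have e2 : (n : ℝ) * (ε - 2 * ℓ) = -(n * (2 * ℓ)) * (1 - ε / (2 * ℓ)) := by
      field_simp; ring
    have e3 : 0 ≤ 1 - ε / (2 * ℓ) := by
      rw [sub_nonneg, div_le_one (by positivity)]; linarith
    have e4 : -(n * (2 * ℓ)) * (1 - ε / (2 * ℓ)) ≤ Real.log z * (1 - ε / (2 * ℓ)) := by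
      gcongr; linarith
    have e5 : -Real.log z * (ε / (2 * ℓ)) ≤ z⁻¹ * (ε / (2 * (1 - l))) := by
      have : ε / (2 * ℓ) ≤ ε / (2 * (1 - l)) := by gcongr
      calc _ ≤ z⁻¹ * (ε / (2 * ℓ)) := by gcongr
        _ ≤ _ := by gcongr
    have e6 : z⁻¹ * (ε / (2 * (1 - l))) ≤ k / 2 := by
      rw [hzdef, show (b⁻¹ * (1 - l))⁻¹ * (ε / (2 * (1 - l))) = ε * b / (2 * (1 - l) ^ 2) by
        field_simp, div_le_div_iff₀ (by positivity) two_pos]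
      linarith
    nlinarith
  rw [← Real.log_le_log_iff (by positivity) (by positivity), Real.log_mul (by positivity) hz.ne',
    Real.log_exp]
  exact h5

/-! ### The spectrum of the momentum matrix -/

/-- The roots of `r² - (γ + 1 - α (1 - γ) κ) r + γ` are eigenvalues of the momentum matrix, with
eigenvector `((1 - r) u, α r u)` for an eigenvector `u` of `S`. -/
lemma norm_root_le_specRad {d : ℕ} {S : Matrix (Fin d) (Fin d) ℝ} {γ α κ : ℝ} (hα : α ≠ 0)
    (hκ : κ ∈ spectrum ℝ S) {r : ℂ}
    (hr : r ^ 2 - ((γ + 1 - α * (1 - γ) * κ : ℝ) : ℂ) * r + γ = 0) : ‖r‖ ≤ specRad S γ α := by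
  set G := (momentumMatrix S γ α).map (algebraMap ℝ ℂ) with hG
  have hmem : r ∈ spectrum ℂ G := by
    rw [← Matrix.spectrum_toLin'] at hκ ⊢
    rw [← Module.End.hasEigenvalue_iff_mem_spectrum] at hκ ⊢
    obtain ⟨u, hu⟩ := hκ.exists_hasEigenvector
    have hSu : S *ᵥ u = κ • u := by simpa using hu.apply_eq_smul
    have hu0 := hu.2
    obtain ⟨i, hi⟩ : ∃ i, u i ≠ 0 := by
      by_contra! h; exact hu0 (funext h)
    have hS' : ∀ i, ∑ j, (S i j : ℂ) * (u j : ℂ) = κ * u i := by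
      intro i
      have := congrFun hSu i
      simp only [Matrix.mulVec, dotProduct, Pi.smul_apply, smul_eq_mul] at this
      exact_mod_cast this
    refine Module.End.hasEigenvalue_of_hasEigenvector (x := Sum.elim
      (fun i => (1 - r) * (u i : ℂ)) (fun i => (α * r) * (u i : ℂ))) ⟨?_, ?_⟩
    · rw [Module.End.mem_eigenspace_iff, Matrix.toLin'_apply, hG, momentumMatrix,
        Matrix.fromBlocks_map, Matrix.fromBlocks_mulVec]
      push_cast at hr
      have hone : ∀ (a : ℝ) (c : ℂ), ((a • (1 : Matrix (Fin d) (Fin d) ℝ)).map (algebraMap ℝ ℂ)) *ᵥ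
          (fun i => c * (u i : ℂ)) = fun i => a * c * (u i : ℂ) := by
        intro a c
        ext i
        simp [Matrix.mulVec, dotProduct, Matrix.one_apply, mul_assoc, apply_ite Complex.ofReal]
      have hSm : ∀ (a : ℝ) (c : ℂ), ((a • S).map (algebraMap ℝ ℂ)) *ᵥ
          (fun i => c * (u i : ℂ)) = fun i => a * c * κ * (u i : ℂ) := by
        intro a c
        ext i
        simp only [Matrix.mulVec, dotProduct, Matrix.map_apply, Matrix.smul_apply, smul_eq_mul,
          Complex.coe_algebraMap]
        have := hS' i
        calc _ = (a * c) * ∑ j, (S i j : ℂ) * (u j : ℂ) := by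
              rw [Finset.mul_sum]; exact Finset.sum_congr rfl fun j _ => by push_cast; ring
          _ = _ := by rw [this]; ring
      have hsub : ((1 - (α * (1 - γ)) • S).map (algebraMap ℝ ℂ) : Matrix (Fin d) (Fin d) ℂ) =
          ((1 : ℝ) • (1 : Matrix (Fin d) (Fin d) ℝ)).map (algebraMap ℝ ℂ)
            - ((α * (1 - γ)) • S).map (algebraMap ℝ ℂ) := by
        ext i j; simp [Matrix.one_apply, apply_ite Complex.ofReal]
      ext x
      rcases x with x | x
      · simp only [Sum.elim_comp_inl, Sum.elim_comp_inr, hone, hSm, Sum.elim_inl, Pi.add_apply,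
          Pi.smul_apply, smul_eq_mul]
        push_cast
        linear_combination (-1) * (-(u x : ℂ)) * hr
      · simp only [Sum.elim_comp_inl, Sum.elim_comp_inr, hsub, Matrix.sub_mulVec, hone, hSm,
          Sum.elim_inr, Pi.add_apply, Pi.sub_apply, Pi.smul_apply, smul_eq_mul]
        push_cast
        linear_combination (-α * (u x : ℂ)) * hr
    · intro h
      have h1 := congrFun h (Sum.inl i)
      have h2 := congrFun h (Sum.inr i)
      have hi' : (u i : ℂ) ≠ 0 := by exact_mod_cast hi
      simp only [Sum.elim_inl, Sum.elim_inr, Pi.zero_apply, mul_eq_zero, hi', or_false,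
        Complex.ofReal_eq_zero, hα, false_or] at h1 h2
      rw [h2] at h1
      simp at h1
  have hfin : spectralRadius ℂ G ≠ ⊤ := by
    have hf : (spectrum ℂ G).Finite := Matrix.finite_spectrum G
    obtain ⟨c, hc⟩ := (hf.image fun k => ‖k‖₊).bddAbove
    refine ne_top_of_le_ne_top (ENNReal.coe_ne_top (r := c)) ?_
    exact iSup₂_le fun k hk => by exact_mod_cast hc ⟨k, hk, rfl⟩
  have h : (‖r‖₊ : ℝ≥0∞) ≤ spectralRadius ℂ G :=
    le_iSup₂ (f := fun k (_ : k ∈ spectrum ℂ G) => (‖k‖₊ : ℝ≥0∞)) r hmem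
  have := ENNReal.toReal_mono hfin h
  simpa [specRad, hG] using this

lemma le_maxEig {d : ℕ} {S : Matrix (Fin d) (Fin d) ℝ} {κ : ℝ} (hκ : κ ∈ spectrum ℝ S) :
    κ ≤ maxEig S :=
  le_csSup (Matrix.finite_spectrum S).bddAbove hκ

lemma minEig_le {d : ℕ} {S : Matrix (Fin d) (Fin d) ℝ} {κ : ℝ} (hκ : κ ∈ spectrum ℝ S) :
    minEig S ≤ κ :=
  csInf_le (Matrix.finite_spectrum S).bddBelow hκ

lemma minDiscr_le {d : ℕ} {S : Matrix (Fin d) (Fin d) ℝ} {κ : ℝ} (γ α : ℝ)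
    (hκ : κ ∈ spectrum ℝ S) : minDiscr S γ α ≤ |(γ + 1 - α * (1 - γ) * κ) ^ 2 - 4 * γ| :=
  csInf_le ((Matrix.finite_spectrum S).image _).bddBelow ⟨κ, hκ, rfl⟩

/-- By Vieta, `(1 - r) (1 - s) = α (1 - γ) κ`, and the smaller root is at distance at least
`(1 - γ) / 2` from `1`; so the spectral gap is at most of order `α`. -/
lemma one_sub_le_of_roots {γ α κ l : ℝ} {r s : ℂ} (hγ₀ : 0 ≤ γ) (hγ₁ : γ < 1) (hα : 0 ≤ α)
    (hκ : 0 ≤ κ) (hl : l ≤ 1) (h₁ : r + s = (γ + 1 - α * (1 - γ) * κ : ℝ)) (h₂ : r * s = γ)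
    (hr : ‖r‖ ≤ l) (hs : ‖s‖ ≤ l) : 1 - l ≤ 2 * α * κ := by
  have hg : 0 < 1 - γ := by linarith
  have hprod : ‖r‖ * ‖s‖ = γ := by
    rw [← norm_mul, h₂, Complex.norm_real, Real.norm_eq_abs, abs_of_nonneg hγ₀]
  have hvieta : (1 - r) * (1 - s) = ((α * (1 - γ) * κ : ℝ) : ℂ) := by
    push_cast at h₁ ⊢
    linear_combination -h₁ + h₂
  have e : ‖1 - r‖ * ‖1 - s‖ = α * (1 - γ) * κ := by
    rw [← norm_mul, hvieta, Complex.norm_real, Real.norm_eq_abs, abs_of_nonneg (by positivity)]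
  have f₁ : 1 - ‖r‖ ≤ ‖1 - r‖ := by simpa using norm_sub_norm_le (1 : ℂ) r
  have f₂ : 1 - ‖s‖ ≤ ‖1 - s‖ := by simpa using norm_sub_norm_le (1 : ℂ) s
  have n₁ := norm_nonneg r
  have n₂ := norm_nonneg s
  have key : (1 - l) * ((1 - γ) / 2) ≤ ‖1 - r‖ * ‖1 - s‖ := by
    rcases le_total ‖r‖ ‖s‖ with hrs | hrs
    · have : (1 - γ) / 2 ≤ 1 - ‖r‖ := by nlinarith [sq_nonneg (1 - ‖r‖)]
      rw [mul_comm]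
      exact mul_le_mul (by linarith) (by linarith) (by linarith) (norm_nonneg _)
    · have : (1 - γ) / 2 ≤ 1 - ‖s‖ := by nlinarith [sq_nonneg (1 - ‖s‖)]
      exact mul_le_mul (by linarith) (by linarith) (by linarith) (norm_nonneg _)
  rw [e] at key
  exact le_of_mul_le_mul_right (by linarith : (1 - l) * (1 - γ) ≤ 2 * α * κ * (1 - γ)) hg

/-- If `α κ` is of order `1 - γ`, so is the distance of the roots from `1`. -/
lemma norm_root_sub_one_le {γ α κ a : ℝ} {z : ℂ} (hγ₀ : 0 ≤ γ) (hγ₁ : γ ≤ 1)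
    (hακ₀ : 0 ≤ α * κ) (hακ : α * κ ≤ a * (1 - γ))
    (hz : z ^ 2 - ((γ + 1 - α * (1 - γ) * κ : ℝ) : ℂ) * z + γ = 0) :
    ‖z - 1‖ ≤ 2 * ((1 - γ) * (1 + a)) := by
  have hg : 0 ≤ 1 - γ := by linarith
  have e : (z - 1) ^ 2 = (((1 - γ) * (1 + α * κ) : ℝ) : ℂ) * (1 - z)
      - (((1 - γ) * (α * κ) : ℝ) : ℂ) := by
    push_cast at hz ⊢
    linear_combination hz
  have e' : ‖z - 1‖ ^ 2 ≤ (1 - γ) * (1 + α * κ) * ‖z - 1‖ + (1 - γ) * (α * κ) := by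
    rw [← norm_pow, e]
    refine (norm_sub_le _ _).trans ?_
    rw [norm_mul, norm_sub_rev 1 z, Complex.norm_real, Complex.norm_real, Real.norm_eq_abs,
      Real.norm_eq_abs, abs_of_nonneg (by positivity), abs_of_nonneg (by positivity)]
  rcases hg.eq_or_lt with h0 | h0
  · rw [← h0] at e' ⊢
    nlinarith [norm_nonneg (z - 1)]
  have ha : 0 ≤ a := by
    by_contra! h
    nlinarith
  have hακ' : α * κ ≤ a := by nlinarith
  have b₁ : (1 - γ) * (1 + α * κ) ≤ (1 - γ) * (1 + a) := by gcongr
  have b₂ : (1 - γ) * (α * κ) ≤ ((1 - γ) * (1 + a)) ^ 2 := by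
    calc (1 - γ) * (α * κ) ≤ (1 - γ) * (a * (1 - γ)) := by gcongr
      _ = (1 - γ) ^ 2 * a := by ring
      _ ≤ (1 - γ) ^ 2 * (1 + a) ^ 2 := by gcongr; nlinarith
      _ = _ := by ring
  have hP : 0 ≤ (1 - γ) * (1 + a) := by positivity
  by_contra! hcon
  have := mul_le_mul_of_nonneg_right b₁ (norm_nonneg (z - 1))
  nlinarith

/-- Bounds on the impulse response of one eigendirection, uniform over parameters for which
`constM` and `α / (1 - λ)` are at most `C`. In particular `1 - λ` is comparable to `α`. -/
lemma impulse_bounds {d : ℕ} {S : Matrix (Fin d) (Fin d) ℝ} {γ α C κ : ℝ} (hμ : 0 < minEig S)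
    (hγ₀ : 0 ≤ γ) (hγ₁ : γ < 1) (hα : 0 < α) (hΔ : 0 < minDiscr S γ α)
    (hM : constM S γ α ≤ C) (hgap : α ≤ C * (1 - specRad S γ α)) (hκ : κ ∈ spectrum ℝ S)
    {h : ℕ → ℝ} (hh : h = impulse (γ + 1 - α * (1 - γ) * κ) γ) :
    0 < specRad S γ α ∧ specRad S γ α < 1 ∧ γ ≤ specRad S γ α ∧
      1 - specRad S γ α ≤ 2 * α * κ ∧
      (∀ t, 4 * (1 - γ) * |h t| ≤ constM S γ α * specRad S γ α ^ t) ∧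
      (∀ t, |h (t + 1) - h t| ≤ C * (1 + C * maxEig S) * specRad S γ α ^ t) ∧
      ∀ t, |h (t + 1) - γ * h t| ≤ C * (1 + C * maxEig S) * specRad S γ α ^ t := by
  have hκ0 : 0 < κ := hμ.trans_le (minEig_le hκ)
  have hκL := le_maxEig hκ
  set L := maxEig S with hL
  have hL0 : 0 < L := hκ0.trans_le hκL
  set l := specRad S γ α with hl
  set p := γ + 1 - α * (1 - γ) * κ with hp
  have hg : 0 < 1 - γ := by linarith
  set Q := √(minDiscr S γ α) with hQ
  have hQ0 : 0 < Q := Real.sqrt_pos.2 hΔ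
  set D := √|p ^ 2 - 4 * γ| with hD
  have hQD : Q ≤ D := Real.sqrt_le_sqrt (minDiscr_le γ α hκ)
  have hMval : constM S γ α = 4 / Q * (2 * (1 - γ) * (1 + α * L + L) + 3 * α * γ) := rfl
  have hM8 : 8 * (1 - γ) / Q ≤ constM S γ α := by
    have h1 : 0 ≤ 2 * (1 - γ) * (α * L + L) := by positivity
    have h2 : 0 ≤ 3 * α * γ := by positivity
    rw [hMval, show 8 * (1 - γ) / Q = 4 / Q * (2 * (1 - γ)) by ring]
    refine mul_le_mul_of_nonneg_left ?_ (by positivity)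
    linarith
  have hM0 : 0 < constM S γ α := lt_of_lt_of_le (by positivity) hM8
  have hC0 : 0 < C := hM0.trans_le hM
  have hl1 : l < 1 := by
    by_contra! hcon
    nlinarith
  have hCg : 8 * (1 - γ) ≤ C * Q := by
    rw [← div_le_iff₀ hQ0]; exact hM8.trans hM
  obtain ⟨r, s, h₁, h₂⟩ := exists_roots p γ
  have hr : ‖r‖ ≤ l := norm_root_le_specRad hα.ne' hκ (by
    rw [← hp]; linear_combination r * h₁ - h₂)
  have hs : ‖s‖ ≤ l := norm_root_le_specRad hα.ne' hκ (by
    rw [← hp]; linear_combination s * h₁ - h₂)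
  have hprod : ‖r‖ * ‖s‖ = γ := by
    rw [← norm_mul, h₂, Complex.norm_real, Real.norm_eq_abs, abs_of_nonneg hγ₀]
  have hl0 : 0 ≤ l := (norm_nonneg _).trans hr
  have hγl : γ ≤ l ^ 2 := by
    rw [← hprod, sq]; gcongr
  have hγl' : γ ≤ l := hγl.trans (by nlinarith)
  have hl0' : 0 < l := by
    rcases hl0.eq_or_lt with h0 | h0
    · -- a vanishing spectral radius would make both roots, hence the discriminant, vanish
      rw [← h0] at hr hs
      have e₁ : r = 0 := by simpa using hr
      have e₂ : s = 0 := by simpa using hs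
      have := norm_sub_of_roots h₁ h₂
      rw [e₁, e₂, sub_zero, norm_zero, ← hD] at this
      linarith
    · exact h0
  have hαg : α ≤ C * (1 - γ) := hgap.trans (by gcongr)
  have hgap' : 1 - l ≤ 2 * α * κ := one_sub_le_of_roots hγ₀ hγ₁ hα.le hκ0.le hl1.le h₁ h₂ hr hs
  have hακ : α * κ ≤ C * L * (1 - γ) := by
    calc α * κ ≤ C * (1 - γ) * L := by gcongr
      _ = _ := by ring
  have hroot := fun z => norm_root_sub_one_le hγ₀ hγ₁.le (by positivity) hακ (z := z)
  have hr' := hroot r (by linear_combination r * h₁ - h₂)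
  have hs' := hroot s (by linear_combination s * h₁ - h₂)
  have B₁ : ∀ t, 4 * (1 - γ) * |h t| ≤ constM S γ α * l ^ t := by
    intro t
    have h1 := sqrt_discr_mul_abs_impulse_le h₁ h₂ hr hs t
    rw [← hD, ← hh] at h1
    have h2 : |h t| ≤ 2 * l ^ t / Q := by
      rw [le_div_iff₀ hQ0]
      calc |h t| * Q ≤ |h t| * D := by gcongr
        _ ≤ _ := by linarith
    calc 4 * (1 - γ) * |h t| ≤ 4 * (1 - γ) * (2 * l ^ t / Q) := by gcongr
      _ = 8 * (1 - γ) / Q * l ^ t := by ring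
      _ ≤ _ := by gcongr
  have B₂ : ∀ t, |h (t + 1) - h t| ≤ C * (1 + C * L) / 2 * l ^ t := by
    intro t
    have h1 := sqrt_discr_mul_abs_impulse_sub_le h₁ h₂ hr hs hr' hs' t
    rw [← hD, ← hh] at h1
    have h2 : |h (t + 1) - h t| * Q ≤ C * (1 + C * L) / 2 * l ^ t * Q := by
      calc |h (t + 1) - h t| * Q ≤ |h (t + 1) - h t| * D := by gcongr
        _ ≤ 2 * (2 * ((1 - γ) * (1 + C * L))) * l ^ t := by linarith
        _ = (8 * (1 - γ)) * ((1 + C * L) / 2 * l ^ t) := by ring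
        _ ≤ (C * Q) * ((1 + C * L) / 2 * l ^ t) := by gcongr
        _ = _ := by ring
    exact le_of_mul_le_mul_right h2 hQ0
  refine ⟨hl0', hl1, hγl', hgap', B₁, fun t => (B₂ t).trans ?_, fun t => ?_⟩
  · have : 0 < l ^ t := by positivity
    have : 0 < C * (1 + C * L) := by positivity
    gcongr
    linarith
  · have e : h (t + 1) - γ * h t = (1 - γ) * h (t + 1) + γ * (h (t + 1) - h t) := by ring
    have h1 := B₁ (t + 1)
    have h2 := B₂ t
    have hlt : 0 < l ^ t := by positivity
    have h3 : constM S γ α * l ^ (t + 1) ≤ C * l ^ t := by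
      rw [pow_succ]
      calc _ ≤ C * (l ^ t * 1) := by gcongr
        _ = _ := by ring
    have h4 : C * l ^ t ≤ C * (1 + C * L) * l ^ t := by
      have : 0 < C * L := by positivity
      gcongr
      nlinarith
    calc |h (t + 1) - γ * h t| ≤ |(1 - γ) * h (t + 1)| + |γ * (h (t + 1) - h t)| := by
          rw [e]; exact abs_add_le _ _
      _ = (1 - γ) * |h (t + 1)| + γ * |h (t + 1) - h t| := by
          rw [abs_mul, abs_mul, abs_of_pos hg, abs_of_nonneg hγ₀]
      _ ≤ (1 - γ) * |h (t + 1)| + 1 * |h (t + 1) - h t| := by gcongr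
      _ ≤ _ := by
        have : 0 < C * (1 + C * L) * l ^ t := by positivity
        linarith

/-! ### Second moments of orthogonal sums -/

section Moments

variable {Ω : Type*} [MeasurableSpace Ω] {P : Measure Ω}

lemma ofReal_integral_norm_sq {V : Type*} [NormedAddCommGroup V] {f : Ω → V} (hf : MemLp f 2 P) :
    ENNReal.ofReal (∫ ω, ‖f ω‖ ^ 2 ∂P) = ∫⁻ ω, ‖f ω‖ₑ ^ 2 ∂P := by
  rw [ofReal_integral_eq_lintegral_ofReal hf.norm.integrable_sq
    (Eventually.of_forall fun ω => by positivity)]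
  refine lintegral_congr fun ω => ?_
  rw [ENNReal.ofReal_pow (norm_nonneg _), ofReal_norm]

lemma memLp_two_of_lintegral_lt_top {V : Type*} [NormedAddCommGroup V] {f : Ω → V}
    (hf : AEStronglyMeasurable f P) (h : ∫⁻ ω, ‖f ω‖ₑ ^ 2 ∂P < ⊤) : MemLp f 2 P := by
  refine ⟨hf, ?_⟩
  rw [eLpNorm_lt_top_iff_lintegral_rpow_enorm_lt_top (by norm_num) (by norm_num)]
  simpa using h

lemma integral_sq_const_add_sum [IsProbabilityMeasure P] {ι : Type*} (a : ℝ) (c : ι → ℝ)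
    {w : ι → Ω → ℝ} (hw : ∀ s, MemLp (w s) 2 P) (h₀ : ∀ s, ∫ ω, w s ω ∂P = 0)
    (horth : ∀ s t, s ≠ t → ∫ ω, w s ω * w t ω ∂P = 0) (F : Finset ι) :
    ∫ ω, (a + ∑ s ∈ F, c s * w s ω) ^ 2 ∂P = a ^ 2 + ∑ s ∈ F, c s ^ 2 * ∫ ω, w s ω ^ 2 ∂P := by
  classical
  induction F using Finset.induction_on with
  | empty => simp
  | insert i F hi ih =>
    have hX : MemLp (fun ω => a + ∑ s ∈ F, c s * w s ω) 2 P :=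
      (memLp_const a).add (memLp_finsetSum _ fun s _ => (hw s).const_mul (c s))
    have hint : ∀ s t, Integrable (fun ω => w s ω * w t ω) P := fun s t =>
      (hw s).integrable_mul (hw t)
    have hcross : ∫ ω, (a + ∑ s ∈ F, c s * w s ω) * w i ω ∂P = 0 := by
      have e : ∀ ω, (a + ∑ s ∈ F, c s * w s ω) * w i ω =
          a * w i ω + ∑ s ∈ F, c s * (w s ω * w i ω) := by
        intro ω
        rw [add_mul, Finset.sum_mul]
        simp only [mul_assoc]
      simp_rw [e]
      rw [integral_add (((hw i).integrable (by norm_num)).const_mul a)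
        (integrable_finsetSum _ fun s _ => (hint s i).const_mul (c s)), integral_const_mul, h₀,
        integral_finsetSum _ fun s _ => (hint s i).const_mul (c s), mul_zero, zero_add]
      refine Finset.sum_eq_zero fun s hs => ?_
      rw [integral_const_mul, horth s i (fun h => hi (h ▸ hs)), mul_zero]
    have e : ∀ ω, (a + ∑ s ∈ insert i F, c s * w s ω) ^ 2 =
        (a + ∑ s ∈ F, c s * w s ω) ^ 2 + 2 * c i * ((a + ∑ s ∈ F, c s * w s ω) * w i ω)
          + c i ^ 2 * w i ω ^ 2 := by
      intro ω
      rw [Finset.sum_insert hi]; ring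
    have i₁ : Integrable (fun ω => (a + ∑ s ∈ F, c s * w s ω) ^ 2) P := hX.integrable_sq
    have i₂ : Integrable (fun ω => 2 * c i * ((a + ∑ s ∈ F, c s * w s ω) * w i ω)) P :=
      (hX.integrable_mul (hw i)).const_mul (2 * c i)
    have i₃ : Integrable (fun ω => c i ^ 2 * w i ω ^ 2) P := (hw i).integrable_sq.const_mul _
    simp_rw [e]
    rw [integral_add (by exact i₁.add i₂) i₃, integral_add i₁ i₂, integral_const_mul, hcross, ih,
      integral_const_mul, Finset.sum_insert hi]
    ring

/-- Bound on the mean square of a vector whose coordinates in an orthonormal basis are linear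
combinations of the coordinates of a deterministic vector and of orthogonal random vectors: the
cross terms vanish in each coordinate separately, although the coefficients depend on it. -/
lemma integral_norm_sq_le_of_coord [IsProbabilityMeasure P] {V : Type*} [NormedAddCommGroup V]
    [InnerProductSpace ℝ V] {ι κ : Type*} [Fintype κ] (e : OrthonormalBasis κ ℝ V)
    {W : ι → Ω → V} (hW : ∀ s, MemLp (W s) 2 P) (h₀ : ∀ s v, ∫ ω, inner ℝ v (W s ω) ∂P = 0)
    (horth : ∀ s t, s ≠ t → ∀ v, ∫ ω, inner ℝ v (W s ω) * inner ℝ v (W t ω) ∂P = 0)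
    (F : Finset ι) {Z : Ω → V} (y : V) {a : κ → ℝ} {c : κ → ι → ℝ}
    (hZ : ∀ j ω, inner ℝ (e j) (Z ω) =
      a j * inner ℝ (e j) y + ∑ s ∈ F, c j s * inner ℝ (e j) (W s ω))
    {a' : ℝ} {c' : ι → ℝ} (ha : ∀ j, |a j| ≤ a') (hc : ∀ j, ∀ s ∈ F, |c j s| ≤ c' s) :
    ∫ ω, ‖Z ω‖ ^ 2 ∂P ≤ a' ^ 2 * ‖y‖ ^ 2 + ∑ s ∈ F, c' s ^ 2 * ∫ ω, ‖W s ω‖ ^ 2 ∂P := by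
  have hw : ∀ j s, MemLp (fun ω => inner ℝ (e j) (W s ω)) 2 P := fun j s => (hW s).const_inner _
  have hZ2 : ∀ j, MemLp (fun ω => inner ℝ (e j) (Z ω)) 2 P := fun j => by
    rw [show (fun ω => inner ℝ (e j) (Z ω)) = fun ω => a j * inner ℝ (e j) y
      + ∑ s ∈ F, c j s * inner ℝ (e j) (W s ω) from funext (hZ j)]
    exact (memLp_const (a j * inner ℝ (e j) y)).add
      (memLp_finsetSum F fun s _ => (hw j s).const_mul (c j s))
  have hn : ∀ x : V, ‖x‖ ^ 2 = ∑ j, inner ℝ (e j) x ^ 2 := fun x =>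
    (e.sum_sq_inner_right x).symm
  simp_rw [hn]
  rw [integral_finsetSum _ fun j _ => (hZ2 j).integrable_sq]
  have h1 : ∀ j, ∫ ω, inner ℝ (e j) (Z ω) ^ 2 ∂P ≤
      a' ^ 2 * inner ℝ (e j) y ^ 2 + ∑ s ∈ F, c' s ^ 2 * ∫ ω, inner ℝ (e j) (W s ω) ^ 2 ∂P := by
    intro j
    simp_rw [hZ]
    rw [integral_sq_const_add_sum _ _ (hw j) (fun s => h₀ s _) (fun s t hst => horth s t hst _),
      mul_pow]
    exact add_le_add
      (mul_le_mul_of_nonneg_right (sq_le_sq.2 ((ha j).trans (le_abs_self _))) (sq_nonneg _))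
      (Finset.sum_le_sum fun s hs => mul_le_mul_of_nonneg_right
        (sq_le_sq.2 ((hc j s hs).trans (le_abs_self _))) (integral_nonneg fun _ => sq_nonneg _))
  refine (Finset.sum_le_sum fun j _ => h1 j).trans (le_of_eq ?_)
  rw [Finset.sum_add_distrib, ← Finset.mul_sum, Finset.sum_comm]
  congr 1
  refine Finset.sum_congr rfl fun s _ => ?_
  rw [← Finset.mul_sum, integral_finsetSum _ fun j _ => (hw j s).integrable_sq]

/-- Freezing an independent variable: a bound on the expectation of `φ (f, y)` for each fixed `y`
holds with `y` replaced by a random `g` independent of `f`. -/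
lemma lintegral_le_of_indepFun [IsFiniteMeasure P] {𝓢 𝓣 : Type*} [MeasurableSpace 𝓢]
    [MeasurableSpace 𝓣] {f : Ω → 𝓢} {g : Ω → 𝓣} (hf : Measurable f) (hg : Measurable g)
    (h : IndepFun f g P) {φ : 𝓢 × 𝓣 → ℝ≥0∞} (hφ : Measurable φ) {ψ : 𝓣 → ℝ≥0∞}
    (hψ : Measurable ψ) (hle : ∀ y, ∫⁻ ω, φ (f ω, y) ∂P ≤ ψ y) :
    ∫⁻ ω, φ (f ω, g ω) ∂P ≤ ∫⁻ ω, ψ (g ω) ∂P := by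
  rw [← lintegral_map hφ (hf.prodMk hg),
    (indepFun_iff_map_prod_eq_prod_map_map hf.aemeasurable hg.aemeasurable).1 h,
    lintegral_prod_symm _ hφ.aemeasurable, ← lintegral_map hψ hg]
  refine lintegral_mono fun y => ?_
  rw [lintegral_map (f := fun x => φ (x, y)) (by fun_prop) hf]
  exact hle y

end Moments

/-! ### Momentum iterations driven by independent linear noise -/

section Noise

variable {d : ℕ} {𝓣 : Type*} [MeasurableSpace 𝓣] {Ω : Type*}

/-- The σ-algebra generated by the samples `X 0, …, X (t - 1)`. -/
abbrev past (X : ℕ → Ω → 𝓣) (t : ℕ) : MeasurableSpace Ω :=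
  ⨆ s ∈ Set.Iio t, MeasurableSpace.comap (X s) inferInstance

lemma past_mono (X : ℕ → Ω → 𝓣) {s t : ℕ} (h : s ≤ t) : past X s ≤ past X t :=
  biSup_mono fun _ hi => lt_of_lt_of_le hi h

lemma measurable_past (X : ℕ → Ω → 𝓣) {s t : ℕ} (h : s < t) : Measurable[past X t] (X s) :=
  Measurable.mono (comap_measurable (X s))
    (le_iSup₂ (f := fun s (_ : s ∈ Set.Iio t) => MeasurableSpace.comap (X s) inferInstance) s h)
    le_rfl

variable [MeasurableSpace Ω]

lemma past_le {X : ℕ → Ω → 𝓣} (hX : ∀ t, Measurable (X t)) (t : ℕ) :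
    past X t ≤ ‹MeasurableSpace Ω› :=
  iSup₂_le fun s _ => (hX s).comap_le

/-- `D (X t)` is a random linear map and `u (X t)` a random vector; both are centered, independent
of the earlier samples, and of mean square at most `ρ` (in each unit direction) and `τ`. -/
structure IsNoise (P : Measure Ω) (X : ℕ → Ω → 𝓣)
    (D : 𝓣 → EuclideanSpace ℝ (Fin d) →L[ℝ] EuclideanSpace ℝ (Fin d))
    (u : 𝓣 → EuclideanSpace ℝ (Fin d)) (ρ τ : ℝ) : Prop where
  measurable_sample : ∀ t, Measurable (X t)
  indep : ∀ t, Indep (MeasurableSpace.comap (X t) inferInstance) (past X t) P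
  measurable_lin : ∀ v, Measurable fun x => D x v
  measurable_add : Measurable u
  memLp_lin : ∀ t v, MemLp (fun ω => D (X t ω) v) 2 P
  memLp_add : ∀ t, MemLp (fun ω => u (X t ω)) 2 P
  mean_lin : ∀ t v v', ∫ ω, inner ℝ v (D (X t ω) v') ∂P = 0
  mean_add : ∀ t v, ∫ ω, inner ℝ v (u (X t ω)) ∂P = 0
  sq_lin : ∀ t v, ∫ ω, ‖D (X t ω) v‖ ^ 2 ∂P ≤ ρ * ‖v‖ ^ 2
  sq_add : ∀ t, ∫ ω, ‖u (X t ω)‖ ^ 2 ∂P ≤ τ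
  lin_nonneg : 0 ≤ ρ
  add_nonneg : 0 ≤ τ

variable {P : Measure Ω} {X : ℕ → Ω → 𝓣}
  {D : 𝓣 → EuclideanSpace ℝ (Fin d) →L[ℝ] EuclideanSpace ℝ (Fin d)}
  {u : 𝓣 → EuclideanSpace ℝ (Fin d)} {ρ τ : ℝ}

lemma IsNoise.indepFun_past (hN : IsNoise P X D u ρ τ) {β : Type*} [MeasurableSpace β] {t : ℕ}
    {φ : Ω → β} (hφ : Measurable[past X t] φ) : IndepFun (X t) φ P := by
  rw [IndepFun_iff_Indep]
  exact indep_of_indep_of_le_right (hN.indep t) hφ.comap_le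

lemma lin_apply_eq_sum (T : EuclideanSpace ℝ (Fin d) →L[ℝ] EuclideanSpace ℝ (Fin d))
    (y : EuclideanSpace ℝ (Fin d)) :
    T y = ∑ k, y k • T (EuclideanSpace.basisFun (Fin d) ℝ k) := by
  conv_lhs => rw [← (EuclideanSpace.basisFun (Fin d) ℝ).sum_repr y, map_sum]
  simp

lemma IsNoise.measurable_lin_uncurry (hN : IsNoise P X D u ρ τ) :
    Measurable fun p : 𝓣 × EuclideanSpace ℝ (Fin d) => D p.1 p.2 := by
  rw [show (fun p : 𝓣 × EuclideanSpace ℝ (Fin d) => D p.1 p.2) = fun p => ∑ k, p.2 k •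
    D p.1 (EuclideanSpace.basisFun (Fin d) ℝ k) from funext fun p => lin_apply_eq_sum _ _]
  refine Finset.measurable_sum _ fun k _ => ?_
  have h₁ : Measurable fun p : 𝓣 × EuclideanSpace ℝ (Fin d) => p.2 k := by fun_prop
  exact h₁.smul ((hN.measurable_lin _).comp measurable_fst)

/-- Independence of the past turns the bound on `D (X t) v` for fixed `v` into one for a random
vector determined by the past. -/
lemma IsNoise.memLp_lin_past [IsProbabilityMeasure P] (hN : IsNoise P X D u ρ τ) {t : ℕ}
    {φ : Ω → EuclideanSpace ℝ (Fin d)} (hφ : Measurable[past X t] φ) (hφ2 : MemLp φ 2 P) :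
    MemLp (fun ω => D (X t ω) (φ ω)) 2 P ∧
      ∫ ω, ‖D (X t ω) (φ ω)‖ ^ 2 ∂P ≤ ρ * ∫ ω, ‖φ ω‖ ^ 2 ∂P := by
  have hφm : Measurable φ := hφ.mono (past_le hN.measurable_sample t) le_rfl
  have hm : Measurable fun ω => D (X t ω) (φ ω) :=
    hN.measurable_lin_uncurry.comp ((hN.measurable_sample t).prodMk hφm)
  have hle : ∫⁻ ω, ‖D (X t ω) (φ ω)‖ₑ ^ 2 ∂P ≤ ENNReal.ofReal (ρ * ∫ ω, ‖φ ω‖ ^ 2 ∂P) := by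
    rw [ENNReal.ofReal_mul hN.lin_nonneg, ofReal_integral_norm_sq hφ2,
      ← lintegral_const_mul _ (by fun_prop)]
    refine lintegral_le_of_indepFun (φ := fun p => ‖D p.1 p.2‖ₑ ^ 2)
      (ψ := fun y => ENNReal.ofReal ρ * ‖y‖ₑ ^ 2) (hN.measurable_sample t) hφm
      (hN.indepFun_past hφ)
      (hN.measurable_lin_uncurry.enorm.pow_const _) (by fun_prop) fun y => ?_
    rw [← ofReal_integral_norm_sq (hN.memLp_lin t y), ← ofReal_norm,
      ← ENNReal.ofReal_pow (norm_nonneg _), ← ENNReal.ofReal_mul hN.lin_nonneg]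
    exact ENNReal.ofReal_le_ofReal (hN.sq_lin t y)
  have hL := memLp_two_of_lintegral_lt_top hm.aestronglyMeasurable
    (hle.trans_lt ENNReal.ofReal_lt_top)
  refine ⟨hL, ?_⟩
  rw [← ofReal_integral_norm_sq hL] at hle
  exact (ENNReal.ofReal_le_ofReal_iff
    (mul_nonneg hN.lin_nonneg (integral_nonneg fun _ => by positivity))).1 hle

lemma IsNoise.integral_mul_add (hN : IsNoise P X D u ρ τ) {t : ℕ}
    {ψ : Ω → ℝ} (hψ : Measurable[past X t] ψ) (v : EuclideanSpace ℝ (Fin d)) :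
    ∫ ω, ψ ω * inner ℝ v (u (X t ω)) ∂P = 0 := by
  have hψm : Measurable ψ := hψ.mono (past_le hN.measurable_sample t) le_rfl
  have hum : Measurable fun x => inner ℝ v (u x) := by
    have := hN.measurable_add
    fun_prop
  have hi : IndepFun ψ (fun ω => inner ℝ v (u (X t ω))) P :=
    ((hN.indepFun_past hψ).comp hum measurable_id).symm
  have := hi.integral_fun_mul_eq_mul_integral hψm.aestronglyMeasurable
    (hum.comp (hN.measurable_sample t)).aestronglyMeasurable
  rw [this, hN.mean_add, mul_zero]

lemma IsNoise.integral_mul_lin [IsProbabilityMeasure P] (hN : IsNoise P X D u ρ τ) {t : ℕ}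
    {φ : Ω → EuclideanSpace ℝ (Fin d)} (hφ : Measurable[past X t] φ) (hφ2 : MemLp φ 2 P)
    {ψ : Ω → ℝ} (hψ : Measurable[past X t] ψ) (hψ2 : MemLp ψ 2 P)
    (v : EuclideanSpace ℝ (Fin d)) :
    ∫ ω, ψ ω * inner ℝ v (D (X t ω) (φ ω)) ∂P = 0 := by
  have hDm : ∀ k : Fin d,
      Measurable fun x => inner ℝ v (D x (EuclideanSpace.basisFun (Fin d) ℝ k)) := fun k => by
    have := hN.measurable_lin (EuclideanSpace.basisFun (Fin d) ℝ k)
    fun_prop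
  have hφk : ∀ k : Fin d, Measurable[past X t] fun ω => φ ω k := fun k =>
    (by fun_prop : Measurable fun x : EuclideanSpace ℝ (Fin d) => x k).comp hφ
  have hφk2 : ∀ k : Fin d, MemLp (fun ω => φ ω k) 2 P := fun k =>
    (EuclideanSpace.proj (𝕜 := ℝ) k).comp_memLp' hφ2
  have hpk : ∀ k : Fin d, Measurable[past X t] fun ω => ψ ω * φ ω k := fun k =>
    hψ.mul (hφk k)
  have hi : ∀ k : Fin d, IndepFun (fun ω => ψ ω * φ ω k)
      (fun ω => inner ℝ v (D (X t ω) (EuclideanSpace.basisFun (Fin d) ℝ k))) P := fun k =>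
    ((hN.indepFun_past (hpk k)).comp (hDm k) measurable_id).symm
  have e : ∀ ω, ψ ω * inner ℝ v (D (X t ω) (φ ω)) = ∑ k, (ψ ω * φ ω k) *
      inner ℝ v (D (X t ω) (EuclideanSpace.basisFun (Fin d) ℝ k)) := by
    intro ω
    rw [lin_apply_eq_sum (D (X t ω)) (φ ω), inner_sum, Finset.mul_sum]
    exact Finset.sum_congr rfl fun k _ => by rw [real_inner_smul_right]; ring
  simp_rw [e]
  rw [integral_finsetSum]
  · refine Finset.sum_eq_zero fun k _ => ?_
    rw [(hi k).integral_fun_mul_eq_mul_integral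
      ((hpk k).mono (past_le hN.measurable_sample t) le_rfl).aestronglyMeasurable
      ((hDm k).comp (hN.measurable_sample t)).aestronglyMeasurable, hN.mean_lin, mul_zero]
  · intro k _
    exact (hi k).integrable_mul (hψ2.integrable_mul (hφk2 k))
      (((hN.memLp_lin t _).const_inner v).integrable (by norm_num))

/-- The momentum iteration for a quadratic with Hessian `H`, with gradient noise `D (X t) y + u (X t)`
at the point `y`. -/
structure IsMomentum (H : EuclideanSpace ℝ (Fin d) →L[ℝ] EuclideanSpace ℝ (Fin d)) (γ α : ℝ)
    (X : ℕ → Ω → 𝓣) (D : 𝓣 → EuclideanSpace ℝ (Fin d) →L[ℝ] EuclideanSpace ℝ (Fin d))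
    (u : 𝓣 → EuclideanSpace ℝ (Fin d)) (m y : ℕ → Ω → EuclideanSpace ℝ (Fin d))
    (y₀ : EuclideanSpace ℝ (Fin d)) : Prop where
  m_zero : ∀ ω, m 0 ω = 0
  y_zero : ∀ ω, y 0 ω = y₀
  m_succ : ∀ t ω, m (t + 1) ω =
    γ • m t ω + (1 - γ) • (H (y t ω) + (D (X t ω) (y t ω) + u (X t ω)))
  y_succ : ∀ t ω, y (t + 1) ω = y t ω - α • m (t + 1) ω

variable {H : EuclideanSpace ℝ (Fin d) →L[ℝ] EuclideanSpace ℝ (Fin d)} {γ α : ℝ}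
  {m y : ℕ → Ω → EuclideanSpace ℝ (Fin d)} {y₀ : EuclideanSpace ℝ (Fin d)}

lemma IsMomentum.measurable (hY : IsMomentum H γ α X D u m y y₀) (hN : IsNoise P X D u ρ τ)
    (t : ℕ) : Measurable[past X t] (m t) ∧ Measurable[past X t] (y t) := by
  induction t with
  | zero =>
    rw [show m 0 = fun _ => 0 from funext hY.m_zero, show y 0 = fun _ => y₀ from funext hY.y_zero]
    exact ⟨measurable_const, measurable_const⟩
  | succ t ih =>
    have h1 := ih.1.mono (past_mono X t.le_succ) le_rfl
    have h2 := ih.2.mono (past_mono X t.le_succ) le_rfl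
    have h3 := measurable_past X t.lt_succ_self
    have hm : Measurable[past X (t + 1)] (m (t + 1)) := by
      rw [funext (hY.m_succ t)]
      exact (h1.const_smul γ).add ((((H.measurable.comp h2).add
        ((hN.measurable_lin_uncurry.comp (h3.prodMk h2)).add
          (hN.measurable_add.comp h3)))).const_smul (1 - γ))
    refine ⟨hm, ?_⟩
    rw [funext (hY.y_succ t)]
    exact h2.sub (hm.const_smul α)

lemma IsMomentum.memLp [IsProbabilityMeasure P] (hY : IsMomentum H γ α X D u m y y₀)
    (hN : IsNoise P X D u ρ τ) (t : ℕ) : MemLp (m t) 2 P ∧ MemLp (y t) 2 P := by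
  induction t with
  | zero =>
    rw [show m 0 = fun _ => 0 from funext hY.m_zero, show y 0 = fun _ => y₀ from funext hY.y_zero]
    exact ⟨memLp_const _, memLp_const _⟩
  | succ t ih =>
    have hm : MemLp (m (t + 1)) 2 P := by
      rw [funext (hY.m_succ t)]
      exact (ih.1.const_smul γ).add (((H.comp_memLp' ih.2).add
        ((hN.memLp_lin_past (hY.measurable hN t).2 ih.2).1.add (hN.memLp_add t))).const_smul
          (1 - γ))
    refine ⟨hm, ?_⟩
    rw [funext (hY.y_succ t)]
    exact ih.2.sub (hm.const_smul α)

/-- The multiplicative noise at different times is centered and orthogonal. -/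
lemma IsMomentum.lin_orthogonal [IsProbabilityMeasure P] (hY : IsMomentum H γ α X D u m y y₀)
    (hN : IsNoise P X D u ρ τ) :
    (∀ t v, ∫ ω, inner ℝ v (D (X t ω) (y t ω)) ∂P = 0) ∧
      ∀ s t, s ≠ t → ∀ v, ∫ ω, inner ℝ v (D (X s ω) (y s ω)) * inner ℝ v (D (X t ω) (y t ω)) ∂P
        = 0 := by
  have hlt : ∀ s t, s < t → ∀ v,
      ∫ ω, inner ℝ v (D (X s ω) (y s ω)) * inner ℝ v (D (X t ω) (y t ω)) ∂P = 0 := by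
    intro s t hst v
    refine hN.integral_mul_lin (hY.measurable hN t).2 (hY.memLp hN t).2
      (ψ := fun ω => inner ℝ v (D (X s ω) (y s ω))) ?_
      ((hN.memLp_lin_past (hY.measurable hN s).2 (hY.memLp hN s).2).1.const_inner v) v
    exact (by fun_prop : Measurable fun x => inner ℝ v x).comp
      (hN.measurable_lin_uncurry.comp ((measurable_past X hst).prodMk
        ((hY.measurable hN s).2.mono (past_mono X hst.le) le_rfl)))
  refine ⟨fun t v => ?_, fun s t hst v => ?_⟩
  · simpa using hN.integral_mul_lin (hY.measurable hN t).2 (hY.memLp hN t).2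
      (ψ := fun _ => 1) measurable_const (memLp_const 1) v
  · rcases lt_or_gt_of_ne hst with h | h
    · exact hlt s t h v
    · simp_rw [mul_comm (inner ℝ v (D (X s _) _))]
      exact hlt t s h v

/-- The total gradient noise at different times is centered and orthogonal, and its mean square is
controlled by that of the iterate. -/
lemma IsMomentum.noise_orthogonal [IsProbabilityMeasure P] (hY : IsMomentum H γ α X D u m y y₀)
    (hN : IsNoise P X D u ρ τ) :
    (∀ t, MemLp (fun ω => D (X t ω) (y t ω) + u (X t ω)) 2 P) ∧
    (∀ t v, ∫ ω, inner ℝ v (D (X t ω) (y t ω) + u (X t ω)) ∂P = 0) ∧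
    (∀ s t, s ≠ t → ∀ v, ∫ ω, inner ℝ v (D (X s ω) (y s ω) + u (X s ω)) *
      inner ℝ v (D (X t ω) (y t ω) + u (X t ω)) ∂P = 0) ∧
    ∀ t, ∫ ω, ‖D (X t ω) (y t ω) + u (X t ω)‖ ^ 2 ∂P ≤
      2 * ρ * ∫ ω, ‖y t ω‖ ^ 2 ∂P + 2 * τ := by
  have hlin := fun t => hN.memLp_lin_past (hY.measurable hN t).2 (hY.memLp hN t).2
  have hW : ∀ t, MemLp (fun ω => D (X t ω) (y t ω) + u (X t ω)) 2 P := fun t =>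
    (hlin t).1.add (hN.memLp_add t)
  have hψ0 : ∀ t, ∀ ψ : Ω → ℝ, Measurable[past X t] ψ → MemLp ψ 2 P → ∀ v,
      ∫ ω, ψ ω * inner ℝ v (D (X t ω) (y t ω) + u (X t ω)) ∂P = 0 := by
    intro t ψ hψ hψ2 v
    simp_rw [inner_add_right, mul_add]
    rw [integral_add (by exact hψ2.integrable_mul ((hlin t).1.const_inner v))
      (by exact hψ2.integrable_mul ((hN.memLp_add t).const_inner v)),
      hN.integral_mul_lin (hY.measurable hN t).2 (hY.memLp hN t).2 hψ hψ2,
      hN.integral_mul_add hψ, add_zero]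
  have hlt : ∀ s t, s < t → ∀ v, ∫ ω, inner ℝ v (D (X s ω) (y s ω) + u (X s ω)) *
      inner ℝ v (D (X t ω) (y t ω) + u (X t ω)) ∂P = 0 := by
    intro s t hst v
    refine hψ0 t (fun ω => inner ℝ v (D (X s ω) (y s ω) + u (X s ω))) ?_ ((hW s).const_inner v) v
    have hXs := measurable_past X hst
    exact (by fun_prop : Measurable fun x => inner ℝ v x).comp
      ((hN.measurable_lin_uncurry.comp (hXs.prodMk
        ((hY.measurable hN s).2.mono (past_mono X hst.le) le_rfl))).add
          (hN.measurable_add.comp hXs))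
  refine ⟨hW, fun t v => ?_, fun s t hst v => ?_, fun t => ?_⟩
  · simpa using hψ0 t (fun _ => 1) measurable_const (memLp_const 1) v
  · rcases lt_or_gt_of_ne hst with h | h
    · exact hlt s t h v
    · simp_rw [mul_comm (inner ℝ v (D (X s _) _ + _))]
      exact hlt t s h v
  · calc ∫ ω, ‖D (X t ω) (y t ω) + u (X t ω)‖ ^ 2 ∂P
        ≤ ∫ ω, (2 * ‖D (X t ω) (y t ω)‖ ^ 2 + 2 * ‖u (X t ω)‖ ^ 2) ∂P := by
          refine integral_mono (hW t).norm.integrable_sq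
            (((hlin t).1.norm.integrable_sq.const_mul 2).add
              ((hN.memLp_add t).norm.integrable_sq.const_mul 2)) fun ω => ?_
          have := norm_add_le (D (X t ω) (y t ω)) (u (X t ω))
          have h2 := pow_le_pow_left₀ (norm_nonneg _) this 2
          dsimp only
          nlinarith [sq_nonneg (‖D (X t ω) (y t ω)‖ - ‖u (X t ω)‖)]
      _ = 2 * ∫ ω, ‖D (X t ω) (y t ω)‖ ^ 2 ∂P + 2 * ∫ ω, ‖u (X t ω)‖ ^ 2 ∂P := by
          rw [integral_add ((hlin t).1.norm.integrable_sq.const_mul 2)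
              ((hN.memLp_add t).norm.integrable_sq.const_mul 2), integral_const_mul,
            integral_const_mul]
      _ ≤ _ := by
          have h1 := (hlin t).2
          have h2 := hN.sq_add t
          nlinarith

end Noise

/-! ### Mean square of the iterates -/

section Bounds

variable {d : ℕ} {𝓣 : Type*} [MeasurableSpace 𝓣] {Ω : Type*} [MeasurableSpace Ω]
  {P : Measure Ω} {X : ℕ → Ω → 𝓣}
  {D : 𝓣 → EuclideanSpace ℝ (Fin d) →L[ℝ] EuclideanSpace ℝ (Fin d)}
  {u : 𝓣 → EuclideanSpace ℝ (Fin d)} {ρ τ : ℝ} {S : Matrix (Fin d) (Fin d) ℝ} {γ α : ℝ}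
  {m y : ℕ → Ω → EuclideanSpace ℝ (Fin d)} {y₀ : EuclideanSpace ℝ (Fin d)}

lemma inner_eigenvectorBasis_toEuclideanCLM (hS : S.IsHermitian) (j : Fin d)
    (v : EuclideanSpace ℝ (Fin d)) :
    inner ℝ (hS.eigenvectorBasis j) (toEuclideanCLM (𝕜 := ℝ) S v) =
      hS.eigenvalues j * inner ℝ (hS.eigenvectorBasis j) v := by
  have hsymm : Sᵀ = S := by simpa [Matrix.IsHermitian] using hS
  rw [inner_toEuclideanCLM, Matrix.dotProduct_mulVec, ← Matrix.mulVec_transpose, hsymm,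
    hS.mulVec_eigenvectorBasis, smul_dotProduct, smul_eq_mul, EuclideanSpace.inner_eq_star_dotProduct,
    dotProduct_comm]
  simp

lemma exists_mem_spectrum (hμ : 0 < minEig S) : ∃ κ, κ ∈ spectrum ℝ S := by
  by_contra! h
  rw [minEig, Set.eq_empty_of_forall_notMem h, Real.sInf_empty] at hμ
  exact lt_irrefl _ hμ

/-- Mean squares of the iterates in terms of the past noise, from the variation of constants formula
in each eigendirection of `S`. -/
lemma IsMomentum.integral_norm_sq_le [IsProbabilityMeasure P] {C : ℝ}
    (hY : IsMomentum (toEuclideanCLM (𝕜 := ℝ) S) γ α X D u m y y₀) (hN : IsNoise P X D u ρ τ)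
    (hS : S.IsHermitian) (hμ : 0 < minEig S)
    (hγ₀ : 0 ≤ γ) (hγ₁ : γ < 1) (hα : 0 < α) (hΔ : 0 < minDiscr S γ α)
    (hM : constM S γ α ≤ C) (hgap : α ≤ C * (1 - specRad S γ α)) (t : ℕ) :
    ∫ ω, ‖y t ω‖ ^ 2 ∂P ≤ (C * (1 + C * maxEig S)) ^ 2 * ‖y₀‖ ^ 2 * specRad S γ α ^ (2 * t)
      + ∑ s ∈ Finset.range t, constM S γ α ^ 2 * α ^ 2 / 16 * specRad S γ α ^ (2 * (t - s)) *
        ∫ ω, ‖D (X s ω) (y s ω) + u (X s ω)‖ ^ 2 ∂P ∧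
    ∫ ω, ‖m t ω‖ ^ 2 ∂P ≤ (C * maxEig S) ^ 2 * ‖y₀‖ ^ 2 * specRad S γ α ^ (2 * t)
      + ∑ s ∈ Finset.range t, (1 - γ) ^ 2 * (C * (1 + C * maxEig S)) ^ 2 *
        specRad S γ α ^ (2 * (t - s - 1)) * ∫ ω, ‖D (X s ω) (y s ω) + u (X s ω)‖ ^ 2 ∂P := by
  obtain ⟨hW, h₀, horth, -⟩ := hY.noise_orthogonal hN
  have hmem := fun j => hS.eigenvalues_mem_spectrum_real j
  have hb := fun j => impulse_bounds hμ hγ₀ hγ₁ hα hΔ hM hgap (hmem j) rfl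
  set l := specRad S γ α with hl
  set L := maxEig S with hL
  have hg : 0 < 1 - γ := by linarith
  set h : Fin d → ℕ → ℝ := fun j => impulse (γ + 1 - α * (1 - γ) * hS.eigenvalues j) γ with hh
  have hsol := fun ω j => momentum_solution (γ := γ) (α := α) (κ := hS.eigenvalues j)
    (y := fun t => inner ℝ (hS.eigenvectorBasis j) (y t ω))
    (m := fun t => inner ℝ (hS.eigenvectorBasis j) (m t ω))
    (w := fun t => inner ℝ (hS.eigenvectorBasis j) (D (X t ω) (y t ω) + u (X t ω)))
    (by simp [hY.m_zero])
    (fun t => by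
      rw [hY.m_succ, inner_add_right, real_inner_smul_right, real_inner_smul_right,
        inner_add_right (hS.eigenvectorBasis j) _ (D (X t ω) (y t ω) + u (X t ω)),
        inner_eigenvectorBasis_toEuclideanCLM])
    (fun t => by rw [hY.y_succ, inner_sub_right, real_inner_smul_right]) (h := h j) rfl t
  constructor
  · refine (integral_norm_sq_le_of_coord hS.eigenvectorBasis hW h₀ horth (Finset.range t) y₀
      (a := fun j => h j (t + 1) - γ * h j t) (c := fun j s => -(α * (1 - γ)) * h j (t - s))
      (a' := C * (1 + C * L) * l ^ t) (c' := fun s => constM S γ α * α / 4 * l ^ (t - s))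
      (fun j ω => ?_) (fun j => (hb j).2.2.2.2.2.2 t) fun j s _ => ?_).trans (le_of_eq ?_)
    · rw [(hsol ω j).1, hY.y_zero]
    · have := (hb j).2.2.2.2.1 (t - s)
      rw [abs_mul, abs_neg, abs_of_pos (by positivity)]
      have := mul_le_mul_of_nonneg_left this hα.le
      simp only [hh]
      linarith
    · congr 1
      · rw [pow_mul]; ring
      · exact Finset.sum_congr rfl fun s _ => by rw [pow_mul]; ring
  · refine (integral_norm_sq_le_of_coord hS.eigenvectorBasis hW h₀ horth (Finset.range t) y₀
      (a := fun j => (1 - γ) * hS.eigenvalues j * h j t)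
      (c := fun j s => (1 - γ) * (h j (t - s) - h j (t - s - 1)))
      (a' := C * L * l ^ t) (c' := fun s => (1 - γ) * (C * (1 + C * L) * l ^ (t - s - 1)))
      (fun j ω => ?_) (fun j => ?_) fun j s hs => ?_).trans (le_of_eq ?_)
    · rw [(hsol ω j).2, hY.y_zero]
    · have h1 := (hb j).2.2.2.2.1 t
      have hl0 : 0 < l := (hb j).1
      have hκ0 : 0 < hS.eigenvalues j := hμ.trans_le (minEig_le (hmem j))
      have hκL : hS.eigenvalues j ≤ L := le_maxEig (hmem j)
      have hlt : 0 < l ^ t := by positivity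
      have h2 : (1 - γ) * |h j t| ≤ C * l ^ t := by
        have : constM S γ α * l ^ t ≤ C * l ^ t := by gcongr
        have : 0 ≤ (1 - γ) * |h j t| := by positivity
        simp only [hh] at *
        linarith
      rw [abs_mul, abs_of_pos (by positivity)]
      calc (1 - γ) * hS.eigenvalues j * |h j t| = hS.eigenvalues j * ((1 - γ) * |h j t|) := by ring
        _ ≤ L * (C * l ^ t) := by
          have : 0 ≤ (1 - γ) * |h j t| := by positivity
          gcongr
          exact hκ0.le.trans hκL
        _ = _ := by ring
    · have h1 := (hb j).2.2.2.2.2.1 (t - s - 1)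
      have e : t - s - 1 + 1 = t - s := by have := Finset.mem_range.1 hs; omega
      rw [e] at h1
      rw [abs_mul, abs_of_pos hg]
      exact mul_le_mul_of_nonneg_left h1 hg.le
    · congr 1
      · rw [pow_mul]; ring
      · exact Finset.sum_congr rfl fun s _ => by rw [pow_mul]; ring

/-- A bound for all iterates, of the order of the initial distance and the gradient noise. -/
noncomputable def burnConst (L C σ r : ℝ) : ℝ := (C * (1 + C * L)) ^ 2 * r ^ 2 + C ^ 4 * σ ^ 2 / 8

/-- The constant in the bounds after the burn-in. -/
noncomputable def iterConst (L C Lf σ r : ℝ) : ℝ :=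
  (C * (1 + C * L)) ^ 2 * r ^ 2 * (Real.exp (C ^ 4 * Lf ^ 2 / 8 / 2) * (2 * L)) + C ^ 3 * σ ^ 2 / 8
    + ((C * L) ^ 2 * r ^ 2 * (2 * L * C ^ 2)
      + (C * (1 + C * L)) ^ 2 * (2 * Lf ^ 2 * burnConst L C σ r + 2 * σ ^ 2) * C)

set_option maxHeartbeats 800000 in
/-- After the burn-in the iterates are of order `√(α / B)` and the momenta of order
`(1 - γ) / √(α B)`, uniformly in the parameters. -/
lemma IsMomentum.integral_norm_sq_le_of_burnIn [IsProbabilityMeasure P] {C Lf σ b : ℝ} {n₀ : ℕ}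
    (hY : IsMomentum (toEuclideanCLM (𝕜 := ℝ) S) γ α X D u m y y₀)
    (hN : IsNoise P X D u (Lf ^ 2 / b) (σ ^ 2 / b)) (hb : 1 ≤ b)
    (hS : S.IsHermitian) (hμ : 0 < minEig S)
    (hγ₀ : 0 ≤ γ) (hγ₁ : γ < 1) (hα : 0 < α) (hΔ : 0 < minDiscr S γ α)
    (hM : constM S γ α ≤ C) (hgap : α ≤ C * (1 - specRad S γ α))
    (hrate : constM S γ α ^ 2 * α ^ 2 * Lf ^ 2 ≤ b * (1 - specRad S γ α))
    (hn₀ : specRad S γ α ^ (2 * n₀) ≤ b⁻¹ * (1 - specRad S γ α)) (t : ℕ) (ht : n₀ ≤ t) :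
    ∫ ω, ‖y t ω‖ ^ 2 ∂P ≤ iterConst (maxEig S) C Lf σ ‖y₀‖ * (α / b) ∧
      ∫ ω, ‖m t ω‖ ^ 2 ∂P ≤ iterConst (maxEig S) C Lf σ ‖y₀‖ * ((1 - γ) ^ 2 / (α * b)) := by
  have hall := hY.integral_norm_sq_le hN hS hμ hγ₀ hγ₁ hα hΔ hM hgap
  have hWb := (hY.noise_orthogonal hN).2.2.2
  obtain ⟨κ, hκ⟩ := exists_mem_spectrum hμ
  obtain ⟨hl0, hl1, hγl, hgapκ, hB₁, -⟩ := impulse_bounds hμ hγ₀ hγ₁ hα hΔ hM hgap hκ rfl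
  have hκ0 : 0 < κ := hμ.trans_le (minEig_le hκ)
  have hκL := le_maxEig hκ
  set l := specRad S γ α with hl
  set L := maxEig S with hL
  set M := constM S γ α with hMdef
  have hL0 : 0 < L := hκ0.trans_le hκL
  have hb0 : 0 < b := by linarith
  have hl' : 0 < 1 - l := by linarith
  have hC0 : 0 < C := by
    by_contra! h
    nlinarith
  have hM0 : 0 ≤ M := by
    have := hB₁ 0
    rw [pow_zero, mul_one] at this
    exact le_trans (by have : 0 < 1 - γ := by linarith
                       positivity) this
  have hgapL : 1 - l ≤ 2 * α * L := hgapκ.trans (by gcongr)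
  have hαg : α ≤ C * (1 - γ) := hgap.trans (by gcongr)
  have hαC : α ≤ C := hgap.trans (by nlinarith)
  set K := C * (1 + C * L) with hK
  set q := M ^ 2 * α ^ 2 / 16 with hq
  set θ := l ^ 2 * (1 + q * (2 * (Lf ^ 2 / b))) with hθ
  have hqρ : q * (2 * (Lf ^ 2 / b)) = M ^ 2 * α ^ 2 * Lf ^ 2 / b / 8 := by rw [hq]; ring
  have hε0 : 0 ≤ q * (2 * (Lf ^ 2 / b)) := by positivity
  have hε : q * (2 * (Lf ^ 2 / b)) ≤ 1 - l := by
    rw [hqρ]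
    have : M ^ 2 * α ^ 2 * Lf ^ 2 / b ≤ 1 - l := by
      rw [div_le_iff₀ hb0]; linarith
    have : 0 ≤ M ^ 2 * α ^ 2 * Lf ^ 2 / b := by positivity
    linarith
  have hθ0 : 0 ≤ θ := by positivity
  have hθ1 : θ ≤ 1 := by
    have : θ ≤ l ^ 2 * (1 + (1 - l)) := by rw [hθ]; gcongr
    nlinarith [mul_nonneg hl0.le (sq_nonneg (1 - l))]
  have hren : ∀ t, ∫ ω, ‖y t ω‖ ^ 2 ∂P ≤
      K ^ 2 * ‖y₀‖ ^ 2 * θ ^ t + q * (2 * (σ ^ 2 / b)) / (1 - l) := by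
    refine fun t => renewal_le hl0.le hl1 (by positivity) (by positivity) (by positivity) hε
      (fun t => (hall t).1.trans ?_) t
    gcongr with s hs
    refine (hWb s).trans (le_of_eq ?_)
    ring
  have hqv : q * (2 * (σ ^ 2 / b)) / (1 - l) ≤ C ^ 3 * σ ^ 2 / 8 * (α / b) := by
    rw [div_le_iff₀ hl', hq]
    calc M ^ 2 * α ^ 2 / 16 * (2 * (σ ^ 2 / b)) = M ^ 2 * (α * α) * σ ^ 2 / b / 8 := by ring
      _ ≤ C ^ 2 * (α * (C * (1 - l))) * σ ^ 2 / b / 8 := by gcongr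
      _ = _ := by ring
  have hαb : α / b ≤ C := (div_le_self hα.le hb).trans hαC
  have hburn : ∀ t, ∫ ω, ‖y t ω‖ ^ 2 ∂P ≤ burnConst L C σ ‖y₀‖ := by
    intro t
    refine (hren t).trans ?_
    rw [burnConst]
    have h1 : K ^ 2 * ‖y₀‖ ^ 2 * θ ^ t ≤ K ^ 2 * ‖y₀‖ ^ 2 * 1 := by
      gcongr
      exact pow_le_one₀ hθ0 hθ1
    have h2 : C ^ 3 * σ ^ 2 / 8 * (α / b) ≤ C ^ 3 * σ ^ 2 / 8 * C := by gcongr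
    calc _ ≤ K ^ 2 * ‖y₀‖ ^ 2 * 1 + C ^ 3 * σ ^ 2 / 8 * C := by linarith
      _ = _ := by rw [hK]; ring
  have hθn : θ ^ t ≤ Real.exp (C ^ 4 * Lf ^ 2 / 8 / 2) * (2 * L) * (α / b) := by
    have h1 := pow_perturbed_le (k := C ^ 4 * Lf ^ 2 / 8) hl0 hl1 hε0 hε hb hn₀ (by
      rw [hqρ, div_div, mul_comm b 8, ← div_div, div_mul_cancel₀ _ hb0.ne']
      calc M ^ 2 * α ^ 2 * Lf ^ 2 / 8 ≤ C ^ 2 * (C * (1 - l)) ^ 2 * Lf ^ 2 / 8 := by gcongr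
        _ = _ := by ring)
    calc θ ^ t ≤ θ ^ n₀ := pow_le_pow_of_le_one hθ0 hθ1 ht
      _ ≤ _ := h1
      _ ≤ Real.exp (C ^ 4 * Lf ^ 2 / 8 / 2) * (b⁻¹ * (2 * α * L)) := by gcongr
      _ = _ := by ring
  have hW : ∀ s, ∫ ω, ‖D (X s ω) (y s ω) + u (X s ω)‖ ^ 2 ∂P ≤
      (2 * Lf ^ 2 * burnConst L C σ ‖y₀‖ + 2 * σ ^ 2) / b := by
    intro s
    refine (hWb s).trans ?_
    calc _ ≤ 2 * (Lf ^ 2 / b) * burnConst L C σ ‖y₀‖ + 2 * (σ ^ 2 / b) := by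
          gcongr; exact hburn s
      _ = _ := by ring
  have hburn0 : 0 ≤ burnConst L C σ ‖y₀‖ := by rw [burnConst]; positivity
  set w := 2 * Lf ^ 2 * burnConst L C σ ‖y₀‖ + 2 * σ ^ 2 with hw
  have hw0 : 0 ≤ w := by positivity
  set K₁ := K ^ 2 * ‖y₀‖ ^ 2 * (Real.exp (C ^ 4 * Lf ^ 2 / 8 / 2) * (2 * L)) + C ^ 3 * σ ^ 2 / 8
    with hK₁
  set K₂ := (C * L) ^ 2 * ‖y₀‖ ^ 2 * (2 * L * C ^ 2) + K ^ 2 * w * C with hK₂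
  have hK₁0 : 0 ≤ K₁ := by positivity
  have hK₂0 : 0 ≤ K₂ := by positivity
  have hI : iterConst L C Lf σ ‖y₀‖ = K₁ + K₂ := rfl
  have hg : 0 < 1 - γ := by linarith
  rw [hI]
  constructor
  · calc ∫ ω, ‖y t ω‖ ^ 2 ∂P ≤ _ := hren t
      _ ≤ K ^ 2 * ‖y₀‖ ^ 2 * (Real.exp (C ^ 4 * Lf ^ 2 / 8 / 2) * (2 * L) * (α / b))
          + C ^ 3 * σ ^ 2 / 8 * (α / b) := by gcongr
      _ = K₁ * (α / b) := by rw [hK₁]; ring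
      _ ≤ (K₁ + K₂) * (α / b) := by gcongr; linarith
  · have hsum : ∑ s ∈ Finset.range t, l ^ (2 * (t - s - 1)) ≤ C / α := by
      have h1 : ∑ s ∈ Finset.range t, l ^ (2 * (t - s - 1)) ≤ ∑ s ∈ Finset.range t, l ^ s := by
        rw [← Finset.sum_range_reflect (fun s => l ^ s)]
        refine Finset.sum_le_sum fun s _ => pow_le_pow_of_le_one hl0.le hl1.le ?_
        omega
      have h2 : (∑ s ∈ Finset.range t, l ^ s) * (1 - l) ≤ 1 := by
        rw [geom_sum_mul_neg]
        have : 0 < l ^ t := by positivity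
        linarith
      rw [le_div_iff₀ hα]
      have h0 : 0 ≤ ∑ s ∈ Finset.range t, l ^ s := Finset.sum_nonneg fun s _ => by positivity
      calc _ ≤ (∑ s ∈ Finset.range t, l ^ s) * (C * (1 - l)) := by gcongr
        _ = C * ((∑ s ∈ Finset.range t, l ^ s) * (1 - l)) := by ring
        _ ≤ C * 1 := by gcongr
        _ = C := mul_one C
    have hlt : l ^ (2 * t) ≤ 2 * L * C ^ 2 * ((1 - γ) ^ 2 / (α * b)) := by
      calc l ^ (2 * t) ≤ l ^ (2 * n₀) := pow_le_pow_of_le_one hl0.le hl1.le (by omega)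
        _ ≤ b⁻¹ * (2 * α * L) := hn₀.trans (by gcongr)
        _ = 2 * L * (α * α) / (α * b) := by field_simp
        _ ≤ 2 * L * ((C * (1 - γ)) * (C * (1 - γ))) / (α * b) := by gcongr
        _ = _ := by ring
    calc ∫ ω, ‖m t ω‖ ^ 2 ∂P ≤ _ := (hall t).2
      _ ≤ (C * L) ^ 2 * ‖y₀‖ ^ 2 * (2 * L * C ^ 2 * ((1 - γ) ^ 2 / (α * b)))
          + ∑ s ∈ Finset.range t, (1 - γ) ^ 2 * K ^ 2 * l ^ (2 * (t - s - 1)) * (w / b) := by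
        gcongr with s hs
        exact hW s
      _ = (C * L) ^ 2 * ‖y₀‖ ^ 2 * (2 * L * C ^ 2 * ((1 - γ) ^ 2 / (α * b)))
          + (1 - γ) ^ 2 * K ^ 2 * (w / b) * ∑ s ∈ Finset.range t, l ^ (2 * (t - s - 1)) := by
        rw [Finset.mul_sum]
        congr 1
        exact Finset.sum_congr rfl fun s _ => by ring
      _ ≤ (C * L) ^ 2 * ‖y₀‖ ^ 2 * (2 * L * C ^ 2 * ((1 - γ) ^ 2 / (α * b)))
          + (1 - γ) ^ 2 * K ^ 2 * (w / b) * (C / α) := by gcongr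
      _ = K₂ * ((1 - γ) ^ 2 / (α * b)) := by rw [hK₂]; field_simp
      _ ≤ _ := by gcongr; linarith

end Bounds

/-! ### The averaged iterate and the averaged noise -/

section Remainder

variable {d : ℕ} {𝓣 : Type*} {Ω : Type*} {X : ℕ → Ω → 𝓣}
  {D : 𝓣 → EuclideanSpace ℝ (Fin d) →L[ℝ] EuclideanSpace ℝ (Fin d)}
  {u : 𝓣 → EuclideanSpace ℝ (Fin d)} {ρ τ : ℝ} {S : Matrix (Fin d) (Fin d) ℝ} {γ α : ℝ}
  {H : EuclideanSpace ℝ (Fin d) →L[ℝ] EuclideanSpace ℝ (Fin d)}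
  {m y : ℕ → Ω → EuclideanSpace ℝ (Fin d)} {y₀ : EuclideanSpace ℝ (Fin d)}

/-- Summation of the recursion: up to boundary terms and the multiplicative noise, the sum of the
iterates is `-H⁻¹` times the sum of the additive noise. -/
lemma IsMomentum.sum_eq (hY : IsMomentum H γ α X D u m y y₀) (hγ : γ ≠ 1) (hα : α ≠ 0)
    {a b : ℕ} (hab : a ≤ b) (ω : Ω) :
    H (∑ s ∈ Finset.Ico a b, y s ω) + ∑ s ∈ Finset.Ico a b, u (X s ω) =
      -∑ s ∈ Finset.Ico a b, D (X s ω) (y s ω) - α⁻¹ • (y b ω - y a ω)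
        + (γ / (1 - γ)) • (m b ω - m a ω) := by
  have hg : 1 - γ ≠ 0 := sub_ne_zero.2 hγ.symm
  induction b, hab using Nat.le_induction with
  | base => simp
  | succ b hab ih =>
    rw [Finset.sum_Ico_succ_top hab, Finset.sum_Ico_succ_top hab, Finset.sum_Ico_succ_top hab,
      map_add]
    have h1 : H (y b ω) + u (X b ω) = (1 - γ)⁻¹ • (m (b + 1) ω - γ • m b ω)
        - D (X b ω) (y b ω) := by
      rw [hY.m_succ, add_sub_cancel_left, smul_smul, inv_mul_cancel₀ hg, one_smul]
      abel
    have h2 : m (b + 1) ω = α⁻¹ • (y b ω - y (b + 1) ω) := by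
      rw [hY.y_succ, sub_sub_cancel, smul_smul, inv_mul_cancel₀ hα, one_smul]
    have h3 : m (b + 1) ω = (1 - γ)⁻¹ • m (b + 1) ω - (γ / (1 - γ)) • m (b + 1) ω := by
      rw [← sub_smul, inv_eq_one_div, ← sub_div, div_self hg, one_smul]
    have h4 : (1 - γ)⁻¹ • (m (b + 1) ω - γ • m b ω) = (α⁻¹ • (y b ω - y (b + 1) ω)
        + (γ / (1 - γ)) • m (b + 1) ω) - (γ / (1 - γ)) • m b ω := by
      rw [← h2, smul_sub, smul_smul, div_eq_inv_mul]
      nth_rewrite 2 [h3]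
      rw [div_eq_inv_mul]
      abel
    calc _ = (H (∑ s ∈ Finset.Ico a b, y s ω) + ∑ s ∈ Finset.Ico a b, u (X s ω))
          + (H (y b ω) + u (X b ω)) := by abel
      _ = _ := by
        rw [ih, h1, h4]
        simp only [smul_sub]
        abel

lemma norm_sq_add_five_le {V : Type*} [SeminormedAddCommGroup V] (a b c e f : V) :
    ‖a + b + c + e + f‖ ^ 2 ≤ 5 * (‖a‖ ^ 2 + ‖b‖ ^ 2 + ‖c‖ ^ 2 + ‖e‖ ^ 2 + ‖f‖ ^ 2) := by
  have h : ‖a + b + c + e + f‖ ≤ ‖a‖ + ‖b‖ + ‖c‖ + ‖e‖ + ‖f‖ :=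
    (norm_add_le _ _).trans (add_le_add_left ((norm_add_le _ _).trans (add_le_add_left
      ((norm_add_le _ _).trans (add_le_add_left (norm_add_le _ _) _)) _)) _)
  have h2 := pow_le_pow_left₀ (norm_nonneg _) h 2
  nlinarith [sq_nonneg (‖a‖ - ‖b‖), sq_nonneg (‖a‖ - ‖c‖), sq_nonneg (‖a‖ - ‖e‖),
    sq_nonneg (‖a‖ - ‖f‖), sq_nonneg (‖b‖ - ‖c‖), sq_nonneg (‖b‖ - ‖e‖), sq_nonneg (‖b‖ - ‖f‖),
    sq_nonneg (‖c‖ - ‖e‖), sq_nonneg (‖c‖ - ‖f‖), sq_nonneg (‖e‖ - ‖f‖)]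

variable [MeasurableSpace 𝓣] [MeasurableSpace Ω] {P : Measure Ω}

lemma integral_norm_sq_add_five_le {V : Type*} [NormedAddCommGroup V] {f₁ f₂ f₃ f₄ f₅ : Ω → V}
    (h₁ : MemLp f₁ 2 P) (h₂ : MemLp f₂ 2 P) (h₃ : MemLp f₃ 2 P) (h₄ : MemLp f₄ 2 P)
    (h₅ : MemLp f₅ 2 P) :
    MemLp (fun ω => f₁ ω + f₂ ω + f₃ ω + f₄ ω + f₅ ω) 2 P ∧
      ∫ ω, ‖f₁ ω + f₂ ω + f₃ ω + f₄ ω + f₅ ω‖ ^ 2 ∂P ≤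
        5 * (∫ ω, ‖f₁ ω‖ ^ 2 ∂P + ∫ ω, ‖f₂ ω‖ ^ 2 ∂P + ∫ ω, ‖f₃ ω‖ ^ 2 ∂P + ∫ ω, ‖f₄ ω‖ ^ 2 ∂P
          + ∫ ω, ‖f₅ ω‖ ^ 2 ∂P) := by
  have h : MemLp (fun ω => f₁ ω + f₂ ω + f₃ ω + f₄ ω + f₅ ω) 2 P :=
    (((h₁.add h₂).add h₃).add h₄).add h₅
  have i₁ := h₁.norm.integrable_sq
  have i₂ := h₂.norm.integrable_sq
  have i₃ := h₃.norm.integrable_sq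
  have i₄ := h₄.norm.integrable_sq
  have i₅ := h₅.norm.integrable_sq
  refine ⟨h, ?_⟩
  rw [← integral_add i₁ i₂, ← integral_add (by exact i₁.add i₂) i₃,
    ← integral_add (by exact (i₁.add i₂).add i₃) i₄,
    ← integral_add (by exact ((i₁.add i₂).add i₃).add i₄) i₅, ← integral_const_mul]
  exact integral_mono h.norm.integrable_sq
    (((((i₁.add i₂).add i₃).add i₄).add i₅).const_mul 5) fun ω => norm_sq_add_five_le _ _ _ _ _

/-- The multiplicative noise accumulates like an orthogonal sum. -/
lemma IsMomentum.integral_sum_lin_le [IsProbabilityMeasure P] {K Lf b : ℝ} {n₀ n : ℕ}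
    (hY : IsMomentum H γ α X D u m y y₀) (hN : IsNoise P X D u (Lf ^ 2 / b) τ) (hb : 0 < b)
    (hn : n₀ ≤ n) (hyK : ∀ t, n₀ ≤ t → ∫ ω, ‖y t ω‖ ^ 2 ∂P ≤ K * (α / b)) :
    ∫ ω, ‖∑ s ∈ Finset.Ico n₀ n, D (X s ω) (y s ω)‖ ^ 2 ∂P ≤
      ((n : ℝ) - n₀) * (Lf ^ 2 / b * (K * (α / b))) := by
  have hlin := fun t => hN.memLp_lin_past (hY.measurable hN t).2 (hY.memLp hN t).2
  have h1 := integral_norm_sq_le_of_coord (EuclideanSpace.basisFun (Fin d) ℝ)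
    (fun s => (hlin s).1) (hY.lin_orthogonal hN).1 (hY.lin_orthogonal hN).2 (Finset.Ico n₀ n)
    (Z := fun ω => ∑ s ∈ Finset.Ico n₀ n, D (X s ω) (y s ω)) 0 (a := fun _ => 0)
    (c := fun _ _ => 1) (a' := 0) (c' := fun _ => 1)
    (fun j ω => by simp only [inner_sum, one_mul, zero_mul, zero_add]) (by simp) (by simp)
  refine h1.trans ?_
  simp only [ne_eq, OfNat.ofNat_ne_zero, not_false_eq_true, zero_pow, zero_mul, one_pow, one_mul,
    zero_add]
  refine (Finset.sum_le_card_nsmul (Finset.Ico n₀ n) _ (Lf ^ 2 / b * (K * (α / b)))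
    fun s hs => (hlin s).2.trans ?_).trans (le_of_eq ?_)
  · exact mul_le_mul_of_nonneg_left (hyK s (Finset.mem_Ico.1 hs).1) (by positivity)
  · rw [Nat.card_Ico, nsmul_eq_mul, Nat.cast_sub hn]

/-- The remainder in `IsMomentum.sum_eq` in mean square. -/
lemma IsMomentum.integral_remainder_le [IsProbabilityMeasure P] {K Lf b : ℝ} {n₀ n : ℕ}
    (hY : IsMomentum H γ α X D u m y y₀) (hN : IsNoise P X D u (Lf ^ 2 / b) τ) (hb : 0 < b)
    (hγ₀ : 0 ≤ γ) (hγ₁ : γ < 1) (hα : 0 < α) (hn : n₀ ≤ n)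
    (hyK : ∀ t, n₀ ≤ t → ∫ ω, ‖y t ω‖ ^ 2 ∂P ≤ K * (α / b))
    (hmK : ∀ t, n₀ ≤ t → ∫ ω, ‖m t ω‖ ^ 2 ∂P ≤ K * ((1 - γ) ^ 2 / (α * b))) :
    MemLp (fun ω => H (∑ s ∈ Finset.Ico n₀ n, y s ω) + ∑ s ∈ Finset.Ico n₀ n, u (X s ω)) 2 P ∧
    ∫ ω, ‖H (∑ s ∈ Finset.Ico n₀ n, y s ω) + ∑ s ∈ Finset.Ico n₀ n, u (X s ω)‖ ^ 2 ∂P ≤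
      5 * K * (((n : ℝ) - n₀) * Lf ^ 2 * α / b ^ 2 + 4 / (α * b)) := by
  have hlin := fun t => hN.memLp_lin_past (hY.measurable hN t).2 (hY.memLp hN t).2
  have hy := fun t => (hY.memLp hN t).2
  have hm := fun t => (hY.memLp hN t).1
  have hg : 0 < 1 - γ := by linarith
  have hDy := hY.integral_sum_lin_le hN hb hn hyK
  have hDmem : MemLp (fun ω => ∑ s ∈ Finset.Ico n₀ n, D (X s ω) (y s ω)) 2 P :=
    memLp_finsetSum _ fun s _ => (hlin s).1
  have hcoef : ∀ ω, H (∑ s ∈ Finset.Ico n₀ n, y s ω) + ∑ s ∈ Finset.Ico n₀ n, u (X s ω) =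
      -(∑ s ∈ Finset.Ico n₀ n, D (X s ω) (y s ω)) + (-α⁻¹) • y n ω + α⁻¹ • y n₀ ω
        + (γ / (1 - γ)) • m n ω + (-(γ / (1 - γ))) • m n₀ ω := by
    intro ω
    rw [hY.sum_eq hγ₁.ne hα.ne' hn]
    simp only [smul_sub, neg_smul]
    abel
  simp_rw [hcoef]
  have hsq : ∀ (c : ℝ) (f : Ω → EuclideanSpace ℝ (Fin d)),
      ∫ ω, ‖c • f ω‖ ^ 2 ∂P = c ^ 2 * ∫ ω, ‖f ω‖ ^ 2 ∂P := fun c f => by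
    simp_rw [norm_smul, mul_pow, Real.norm_eq_abs, sq_abs]
    exact integral_const_mul _ _
  obtain ⟨hmem, hle⟩ := integral_norm_sq_add_five_le hDmem.neg ((hy n).const_smul (-α⁻¹))
    ((hy n₀).const_smul α⁻¹) ((hm n).const_smul (γ / (1 - γ))) ((hm n₀).const_smul (-(γ / (1 - γ))))
  refine ⟨hmem, hle.trans ?_⟩
  simp only [Pi.neg_apply, Pi.smul_apply, norm_neg, hsq, neg_sq]
  have b₁ : ∀ t, n₀ ≤ t → α⁻¹ ^ 2 * ∫ ω, ‖y t ω‖ ^ 2 ∂P ≤ K / (α * b) := fun t ht => by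
    calc _ ≤ α⁻¹ ^ 2 * (K * (α / b)) := by gcongr; exact hyK t ht
      _ = _ := by field_simp
  have b₂ : ∀ t, n₀ ≤ t → (γ / (1 - γ)) ^ 2 * ∫ ω, ‖m t ω‖ ^ 2 ∂P ≤ K / (α * b) := fun t ht => by
    calc _ ≤ (1 / (1 - γ)) ^ 2 * ∫ ω, ‖m t ω‖ ^ 2 ∂P :=
          mul_le_mul_of_nonneg_right (by gcongr) (integral_nonneg fun _ => by positivity)
      _ ≤ (1 / (1 - γ)) ^ 2 * (K * ((1 - γ) ^ 2 / (α * b))) := by gcongr; exact hmK t ht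
      _ = _ := by field_simp
  have e : 5 * K * (((n : ℝ) - n₀) * Lf ^ 2 * α / b ^ 2 + 4 / (α * b)) =
      5 * (((n : ℝ) - n₀) * (Lf ^ 2 / b * (K * (α / b))) + K / (α * b) + K / (α * b)
        + K / (α * b) + K / (α * b)) := by
    field_simp
    ring
  rw [e]
  linarith [b₁ n hn, b₁ n₀ le_rfl, b₂ n hn, b₂ n₀ le_rfl]

end Remainder

/-! ### Gradients and moments of the quadratic losses -/

section Losses

variable {d : ℕ}

lemma hasGradientAt_quadLoss {A : Matrix (Fin d) (Fin d) ℝ} (hA : A.IsSymm)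
    (b : EuclideanSpace ℝ (Fin d)) (c : ℝ) (x : EuclideanSpace ℝ (Fin d)) :
    HasGradientAt (quadLoss A b c) (toEuclideanCLM (𝕜 := ℝ) A x - b) x := by
  set T := toEuclideanCLM (𝕜 := ℝ) A with hT
  have e : quadLoss A b c = fun x => (1 / 2) * inner ℝ x (T x) - inner ℝ b x + c := by
    funext x
    rw [quadLoss, hT, inner_toEuclideanCLM, EuclideanSpace.inner_eq_star_dotProduct,
      dotProduct_comm b.ofLp]
    simp
  rw [e, hasGradientAt_iff_hasFDerivAt]
  have h1 := (((hasFDerivAt_id x).inner ℝ (T.hasFDerivAt (x := x))).const_mul (1 / 2)).sub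
    ((innerSL ℝ b).hasFDerivAt (x := x))
  refine (h1.add_const c).congr_fderiv ?_
  ext v
  have hsymm : inner ℝ x (T v) = inner ℝ (T x) v := by
    rw [hT, real_inner_comm v, inner_toEuclideanCLM, inner_toEuclideanCLM,
      Matrix.dotProduct_mulVec, ← Matrix.mulVec_transpose, hA.eq, dotProduct_comm]
  simp [hsymm, real_inner_comm v (T x)]
  ring

lemma gradient_batchLoss {E : Type*} {B : ℕ} {A : E → Matrix (Fin d) (Fin d) ℝ}
    {b : E → EuclideanSpace ℝ (Fin d)} {c : ℝ} (hsymm : ∀ e, (A e).IsSymm)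
    {f : E → EuclideanSpace ℝ (Fin d) → ℝ} (hf : ∀ e, f e = quadLoss (A e) (b e) c)
    (η : Fin B → E) (x : EuclideanSpace ℝ (Fin d)) :
    gradient (batchLoss f η) x =
      (1 / (B : ℝ)) • ∑ i, (toEuclideanCLM (𝕜 := ℝ) (A (η i)) x - b (η i)) := by
  refine HasGradientAt.gradient ?_
  rw [hasGradientAt_iff_hasFDerivAt]
  have h := (HasFDerivAt.fun_sum (u := Finset.univ) fun i _ =>
    (hasGradientAt_quadLoss (hsymm (η i)) (b (η i)) c x).hasFDerivAt).const_mul (1 / (B : ℝ))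
  have e : batchLoss f η = fun x => (1 / (B : ℝ)) * ∑ i, quadLoss (A (η i)) (b (η i)) c x := by
    funext x
    simp only [batchLoss, hf]
  rw [e]
  refine h.congr_fderiv ?_
  rw [map_smul, map_sum]

variable {E : Type*} [MeasurableSpace E] {ν : Measure E} {A : E → Matrix (Fin d) (Fin d) ℝ}
  {b : E → EuclideanSpace ℝ (Fin d)} {c : ℝ} {f : E → EuclideanSpace ℝ (Fin d) → ℝ}
  {xs : EuclideanSpace ℝ (Fin d)} {σ Lf : ℝ}

lemma measurable_toEuclideanCLM_apply (hA : ∀ i j, Measurable fun e => A e i j)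
    (v : EuclideanSpace ℝ (Fin d)) : Measurable fun e => toEuclideanCLM (𝕜 := ℝ) (A e) v := by
  refine (WithLp.measurable_toLp 2 _).comp (g := WithLp.toLp 2) (f := fun e => A e *ᵥ v.ofLp)
    (measurable_pi_lambda _ fun i => ?_)
  simp only [Matrix.mulVec, dotProduct]
  exact Finset.measurable_fun_sum Finset.univ fun j _ => (hA i j).mul_const _

lemma enorm_toEuclideanCLM_le_gradLip {A : Matrix (Fin d) (Fin d) ℝ} (hA : A.IsSymm)
    (b : EuclideanSpace ℝ (Fin d)) (c : ℝ) (xs v : EuclideanSpace ℝ (Fin d)) :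
    ‖toEuclideanCLM (𝕜 := ℝ) A v‖ₑ ≤ gradLip (quadLoss A b c) xs * ‖v‖ₑ := by
  rcases eq_or_ne v 0 with rfl | hv
  · simp
  have h : ‖gradient (quadLoss A b c) (xs + v) - gradient (quadLoss A b c) xs‖ₑ / ‖xs + v - xs‖ₑ ≤
      gradLip (quadLoss A b c) xs :=
    le_iSup (fun x => ‖gradient (quadLoss A b c) x - gradient (quadLoss A b c) xs‖ₑ / ‖x - xs‖ₑ)
      (xs + v)
  rw [(hasGradientAt_quadLoss hA b c _).gradient, (hasGradientAt_quadLoss hA b c _).gradient,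
    add_sub_cancel_left, map_add, sub_sub_sub_cancel_right, add_sub_cancel_left] at h
  rwa [ENNReal.div_le_iff (enorm_ne_zero.2 hv) enorm_ne_top] at h

lemma memLp_toEuclideanCLM (hA : ∀ i j, Measurable fun e => A e i j)
    (hsymm : ∀ e, (A e).IsSymm) (hf : ∀ e, f e = quadLoss (A e) (b e) c)
    (hLip : ∫⁻ e, gradLip (f e) xs ^ 2 ∂ν ≤ ENNReal.ofReal (Lf ^ 2))
    (v : EuclideanSpace ℝ (Fin d)) :
    MemLp (fun e => toEuclideanCLM (𝕜 := ℝ) (A e) v) 2 ν ∧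
      ∫ e, ‖toEuclideanCLM (𝕜 := ℝ) (A e) v‖ ^ 2 ∂ν ≤ Lf ^ 2 * ‖v‖ ^ 2 := by
  have hle : ∫⁻ e, ‖toEuclideanCLM (𝕜 := ℝ) (A e) v‖ₑ ^ 2 ∂ν ≤
      ENNReal.ofReal (Lf ^ 2 * ‖v‖ ^ 2) := by
    calc ∫⁻ e, ‖toEuclideanCLM (𝕜 := ℝ) (A e) v‖ₑ ^ 2 ∂ν
        ≤ ∫⁻ e, gradLip (f e) xs ^ 2 * ‖v‖ₑ ^ 2 ∂ν := by
          refine lintegral_mono fun e => ?_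
          rw [← mul_pow, hf]
          exact pow_le_pow_left' (enorm_toEuclideanCLM_le_gradLip (hsymm e) _ _ _ _) 2
      _ = (∫⁻ e, gradLip (f e) xs ^ 2 ∂ν) * ‖v‖ₑ ^ 2 :=
          lintegral_mul_const' _ _ (by finiteness)
      _ ≤ ENNReal.ofReal (Lf ^ 2) * ‖v‖ₑ ^ 2 := by gcongr
      _ = _ := by
          rw [ENNReal.ofReal_mul (sq_nonneg _), ENNReal.ofReal_pow (norm_nonneg _), ofReal_norm]
  have hm := memLp_two_of_lintegral_lt_top
    (measurable_toEuclideanCLM_apply hA v).aestronglyMeasurable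
    (hle.trans_lt ENNReal.ofReal_lt_top)
  refine ⟨hm, ?_⟩
  rw [← ofReal_integral_norm_sq hm] at hle
  exact (ENNReal.ofReal_le_ofReal_iff (by positivity)).1 hle

/-- The gradient noise `A_ξ x* - b_ξ` at the minimizer. -/
noncomputable def gradNoise (A : E → Matrix (Fin d) (Fin d) ℝ) (b : E → EuclideanSpace ℝ (Fin d))
    (xs : EuclideanSpace ℝ (Fin d)) (e : E) : EuclideanSpace ℝ (Fin d) :=
  toEuclideanCLM (𝕜 := ℝ) (A e) xs - b e

lemma measurable_gradNoise (hA : ∀ i j, Measurable fun e => A e i j) (hb : Measurable b) :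
    Measurable (gradNoise A b xs) :=
  (measurable_toEuclideanCLM_apply hA xs).sub hb

lemma memLp_gradNoise (hA : ∀ i j, Measurable fun e => A e i j) (hb : Measurable b)
    (hsymm : ∀ e, (A e).IsSymm) (hf : ∀ e, f e = quadLoss (A e) (b e) c)
    (hgrad : ∫⁻ e, ‖gradient (f e) xs‖ₑ ^ 2 ∂ν ≤ ENNReal.ofReal (σ ^ 2)) :
    MemLp (gradNoise A b xs) 2 ν ∧ ∫ e, ‖gradNoise A b xs e‖ ^ 2 ∂ν ≤ σ ^ 2 := by
  have e : ∀ e, gradient (f e) xs = gradNoise A b xs e := fun e => by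
    rw [hf, (hasGradientAt_quadLoss (hsymm e) _ _ _).gradient, gradNoise]
  simp_rw [e] at hgrad
  have hm := memLp_two_of_lintegral_lt_top (measurable_gradNoise hA hb).aestronglyMeasurable
    (hgrad.trans_lt ENNReal.ofReal_lt_top)
  refine ⟨hm, ?_⟩
  rw [← ofReal_integral_norm_sq hm] at hgrad
  exact (ENNReal.ofReal_le_ofReal_iff (sq_nonneg _)).1 hgrad

lemma integral_euclidean_apply {g : E → EuclideanSpace ℝ (Fin d)} (hg : Integrable g ν)
    (i : Fin d) : (∫ e, g e ∂ν) i = ∫ e, g e i ∂ν :=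
  ((EuclideanSpace.proj (𝕜 := ℝ) i).integral_comp_comm hg).symm

/-- The Hessian of the population loss is the mean of the Hessians. -/
lemma integral_toEuclideanCLM (hA : ∀ v, Integrable (fun e => toEuclideanCLM (𝕜 := ℝ) (A e) v) ν)
    (v : EuclideanSpace ℝ (Fin d)) :
    ∫ e, toEuclideanCLM (𝕜 := ℝ) (A e) v ∂ν = toEuclideanCLM (𝕜 := ℝ) (hessian ν A) v := by
  have hAij : ∀ i j, Integrable (fun e => A e i j) ν := fun i j => by
    refine ((EuclideanSpace.proj (𝕜 := ℝ) i).integrable_comp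
      (hA (EuclideanSpace.single j 1))).congr (Eventually.of_forall fun e => ?_)
    simp
  ext i
  rw [integral_euclidean_apply (hA v)]
  simp only [ofLp_toEuclideanCLM, Matrix.mulVec, dotProduct, hessian, Matrix.of_apply]
  rw [integral_finsetSum _ fun j _ => (hAij i j).mul_const _]
  exact Finset.sum_congr rfl fun j _ => integral_mul_const _ _

lemma isSymm_hessian (hsymm : ∀ e, (A e).IsSymm) : (hessian ν A).IsSymm := by
  ext i j
  simp only [Matrix.transpose_apply, hessian, Matrix.of_apply]
  exact integral_congr_ae (Eventually.of_forall fun e => (hsymm e).apply i j)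

/-- First order optimality of the minimizer: the gradient noise is centered. -/
lemma integral_gradNoise_eq_zero [IsProbabilityMeasure ν] (hsymm : ∀ e, (A e).IsSymm)
    (hf : ∀ e, f e = quadLoss (A e) (b e) c)
    (hA : ∀ v, Integrable (fun e => toEuclideanCLM (𝕜 := ℝ) (A e) v) ν)
    (hz : Integrable (gradNoise A b xs) ν)
    (hxs : IsMinOn (popLoss ν f) Set.univ xs) : ∫ e, gradNoise A b xs e ∂ν = 0 := by
  have hb : Integrable b ν := by
    refine ((hA xs).sub hz).congr (Eventually.of_forall fun e => ?_)
    simp [gradNoise]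
  have hpop : popLoss ν f = quadLoss (hessian ν A) (∫ e, b e ∂ν) c := by
    funext x
    have e1 : ∀ e, f e x = (1 / 2) * inner ℝ x (toEuclideanCLM (𝕜 := ℝ) (A e) x)
        - inner ℝ x (b e) + c := fun e => by
      rw [hf, quadLoss, inner_toEuclideanCLM, EuclideanSpace.inner_eq_star_dotProduct]
      simp
    simp only [popLoss, e1]
    have i₁ : Integrable (fun e => (1 / 2) * inner ℝ x (toEuclideanCLM (𝕜 := ℝ) (A e) x)) ν :=
      ((hA x).const_inner x).const_mul _
    have i₂ : Integrable (fun e => inner ℝ x (b e)) ν := hb.const_inner x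
    rw [integral_add (by exact i₁.sub i₂) (integrable_const c), integral_sub i₁ i₂, integral_const_mul,
      integral_inner (hA x), integral_inner hb, integral_toEuclideanCLM hA, quadLoss,
      inner_toEuclideanCLM, EuclideanSpace.inner_eq_star_dotProduct]
    simp
  have hmin : IsLocalMin (popLoss ν f) xs := hxs.isLocalMin univ_mem
  rw [hpop] at hmin
  have h0 := hmin.hasFDerivAt_eq_zero
    (hasGradientAt_quadLoss (isSymm_hessian hsymm) (∫ e, b e ∂ν) c xs).hasFDerivAt
  rw [LinearIsometryEquiv.map_eq_zero_iff] at h0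
  simp only [gradNoise]
  rw [integral_sub (hA xs) hb, integral_toEuclideanCLM hA, h0]

end Losses

/-! ### Mini-batch noise -/

section Batch

variable {d : ℕ} {E : Type*} [MeasurableSpace E] {ν : Measure E}
  {Ω : Type*} [MeasurableSpace Ω] {P : Measure Ω} {B : ℕ}

lemma memLp_comp_law {V : Type*} [NormedAddCommGroup V] {ζ : Ω → E} (hζ : Measurable ζ)
    (hlaw : P.map ζ = ν) {g : E → V} (hg : MemLp g 2 ν) : MemLp (fun ω => g (ζ ω)) 2 P := by
  rw [← hlaw] at hg
  exact hg.comp_of_map hζ.aemeasurable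

/-- The batch mean of a centered function of the samples is centered, and averaging over `B`
independent samples divides the mean square by `B`. -/
lemma batchMean_moments [IsProbabilityMeasure P] (hB : 0 < B) {ζ : Fin B → Ω → E}
    (hζ : ∀ i, Measurable (ζ i)) (hlaw : ∀ i, P.map (ζ i) = ν)
    (hind : ∀ i j, i ≠ j → IndepFun (ζ i) (ζ j) P) {g : E → EuclideanSpace ℝ (Fin d)}
    (hgm : Measurable g) (hg : MemLp g 2 ν) (hg₀ : ∫ e, g e ∂ν = 0) :
    MemLp (fun ω => (1 / (B : ℝ)) • ∑ i, g (ζ i ω)) 2 P ∧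
      (∀ v, ∫ ω, inner ℝ v ((1 / (B : ℝ)) • ∑ i, g (ζ i ω)) ∂P = 0) ∧
      ∫ ω, ‖(1 / (B : ℝ)) • ∑ i, g (ζ i ω)‖ ^ 2 ∂P ≤ (∫ e, ‖g e‖ ^ 2 ∂ν) / B := by
  have hB' : (0 : ℝ) < B := by exact_mod_cast hB
  have hgi : ∀ i, MemLp (fun ω => g (ζ i ω)) 2 P := fun i => memLp_comp_law (hζ i) (hlaw i) hg
  have : IsProbabilityMeasure ν := by
    rw [← hlaw ⟨0, hB⟩]
    exact Measure.isProbabilityMeasure_map (hζ _).aemeasurable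
  have h₀ : ∀ i v, ∫ ω, inner ℝ v (g (ζ i ω)) ∂P = 0 := by
    intro i v
    rw [← integral_map (f := fun e => inner ℝ v (g e)) (hζ i).aemeasurable
      (by rw [hlaw]; exact (hg.const_inner v).1), hlaw,
      integral_inner (hg.integrable (by norm_num)), hg₀, inner_zero_right]
  have horth : ∀ i j, i ≠ j → ∀ v, ∫ ω, inner ℝ v (g (ζ i ω)) * inner ℝ v (g (ζ j ω)) ∂P = 0 := by
    intro i j hij v
    have hm : Measurable fun e => inner ℝ v (g e) := by fun_prop
    have := ((hind i j hij).comp hm hm).integral_fun_mul_eq_mul_integral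
      (hm.comp (hζ i)).aestronglyMeasurable (hm.comp (hζ j)).aestronglyMeasurable
    simp only [Function.comp_apply] at this
    rw [this, h₀, zero_mul]
  have hsum : MemLp (fun ω => ∑ i, g (ζ i ω)) 2 P := memLp_finsetSum _ fun i _ => hgi i
  refine ⟨hsum.const_smul (1 / (B : ℝ)), fun v => ?_, ?_⟩
  · simp_rw [real_inner_smul_right, inner_sum]
    rw [integral_const_mul, integral_finsetSum _ fun i _ =>
      ((hgi i).const_inner v).integrable (by norm_num), Finset.sum_eq_zero fun i _ => h₀ i v,
      mul_zero]
  · have h := integral_norm_sq_le_of_coord (EuclideanSpace.basisFun (Fin d) ℝ) hgi h₀ horth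
      Finset.univ (Z := fun ω => (1 / (B : ℝ)) • ∑ i, g (ζ i ω)) 0 (a := fun _ => 0)
      (c := fun _ _ => 1 / (B : ℝ)) (a' := 0) (c' := fun _ => 1 / (B : ℝ))
      (fun j ω => by rw [real_inner_smul_right, inner_sum, Finset.mul_sum]; simp) (by simp)
      (fun _ _ _ => by rw [abs_of_pos (by positivity)])
    have hsq : ∀ i, ∫ ω, ‖g (ζ i ω)‖ ^ 2 ∂P = ∫ e, ‖g e‖ ^ 2 ∂ν := fun i => by
      rw [← integral_map (f := fun e => ‖g e‖ ^ 2) (hζ i).aemeasurable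
        (by rw [hlaw]; exact hg.norm.integrable_sq.1), hlaw]
    refine h.trans (le_of_eq ?_)
    simp only [hsq, Finset.sum_const, Finset.card_univ, Fintype.card_fin, nsmul_eq_mul]
    field_simp
    simp

lemma integral_norm_sub_mean_sq_le [IsProbabilityMeasure ν] {g : E → EuclideanSpace ℝ (Fin d)}
    (hg : MemLp g 2 ν) : ∫ e, ‖g e - ∫ x, g x ∂ν‖ ^ 2 ∂ν ≤ ∫ e, ‖g e‖ ^ 2 ∂ν := by
  set a := ∫ x, g x ∂ν with ha
  have hi : Integrable g ν := hg.integrable (by norm_num)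
  have e : ∀ x, ‖g x - a‖ ^ 2 = ‖g x‖ ^ 2 - 2 * inner ℝ a (g x) + ‖a‖ ^ 2 := fun x => by
    rw [norm_sub_sq_real, real_inner_comm]
  simp_rw [e]
  have i₁ := hg.norm.integrable_sq
  have i₂ : Integrable (fun x => 2 * inner ℝ a (g x)) ν := (hi.const_inner a).const_mul 2
  rw [integral_add (by exact i₁.sub i₂) (integrable_const _), integral_sub i₁ i₂,
    integral_const_mul, integral_inner hi, ← ha, real_inner_self_eq_norm_sq]
  simp only [integral_const, probReal_univ, smul_eq_mul, one_mul]
  nlinarith [sq_nonneg ‖a‖]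

variable {A : E → Matrix (Fin d) (Fin d) ℝ} {b : E → EuclideanSpace ℝ (Fin d)} {c : ℝ}
  {f : E → EuclideanSpace ℝ (Fin d) → ℝ} {xs : EuclideanSpace ℝ (Fin d)} {σ Lf : ℝ}

/-- The deviation of the Hessian of a mini-batch loss from the population Hessian. -/
noncomputable def batchLin (ν : Measure E) (A : E → Matrix (Fin d) (Fin d) ℝ) (η : Fin B → E) :
    EuclideanSpace ℝ (Fin d) →L[ℝ] EuclideanSpace ℝ (Fin d) :=
  (1 / (B : ℝ)) • ∑ i, (toEuclideanCLM (𝕜 := ℝ) (A (η i)) - toEuclideanCLM (𝕜 := ℝ) (hessian ν A))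

/-- The gradient of a mini-batch loss at the minimizer of the population loss. -/
noncomputable def batchGradNoise (A : E → Matrix (Fin d) (Fin d) ℝ)
    (b : E → EuclideanSpace ℝ (Fin d)) (xs : EuclideanSpace ℝ (Fin d)) (η : Fin B → E) :
    EuclideanSpace ℝ (Fin d) :=
  (1 / (B : ℝ)) • ∑ i, gradNoise A b xs (η i)

lemma batchLin_apply (η : Fin B → E) (v : EuclideanSpace ℝ (Fin d)) :
    batchLin ν A η v = (1 / (B : ℝ)) • ∑ i,
      (toEuclideanCLM (𝕜 := ℝ) (A (η i)) v - toEuclideanCLM (𝕜 := ℝ) (hessian ν A) v) := by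
  simp [batchLin]

/-- The centered run is a momentum iteration with time shifted by one: index `t` refers to
`(m_{t+1}, x_{t+1} - x*)`, and the step from it uses the batch `t + 1`. -/
lemma isMomentum_sgdm {Ω' : Type*} (hB : 0 < B) (hsymm : ∀ e, (A e).IsSymm)
    (hf : ∀ e, f e = quadLoss (A e) (b e) c) (γ α : ℝ) (x₁ : EuclideanSpace ℝ (Fin d))
    (ξ : ℕ → Fin B → Ω' → E) :
    IsMomentum (toEuclideanCLM (𝕜 := ℝ) (hessian ν A)) γ α (fun t ω i => ξ (t + 1) i ω)
      (batchLin ν A) (batchGradNoise A b xs)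
      (fun t ω => (sgdm f γ α (fun t i => ξ t i ω) x₁ (t + 1)).1)
      (fun t ω => (sgdm f γ α (fun t i => ξ t i ω) x₁ (t + 1)).2 - xs) (x₁ - xs) where
  m_zero _ := rfl
  y_zero _ := rfl
  y_succ t ω := by
    simp only [sgdm]
    abel
  m_succ t ω := by
    have hB' : (B : ℝ) ≠ 0 := by exact_mod_cast hB.ne'
    simp only [sgdm]
    rw [gradient_batchLoss hsymm hf, batchLin_apply, batchGradNoise, ← smul_add,
      ← Finset.sum_add_distrib]
    congr 2
    set x := (sgdm f γ α (fun t i => ξ t i ω) x₁ (t + 1)).2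
    have e : ∀ i : Fin B, toEuclideanCLM (𝕜 := ℝ) (A (ξ (t + 1) i ω)) x - b (ξ (t + 1) i ω) =
        toEuclideanCLM (𝕜 := ℝ) (hessian ν A) (x - xs)
          + (toEuclideanCLM (𝕜 := ℝ) (A (ξ (t + 1) i ω)) (x - xs)
            - toEuclideanCLM (𝕜 := ℝ) (hessian ν A) (x - xs) + gradNoise A b xs (ξ (t + 1) i ω)) := by
      intro i
      rw [gradNoise, map_sub (toEuclideanCLM (𝕜 := ℝ) (A (ξ (t + 1) i ω)))]
      abel
    rw [Finset.sum_congr rfl fun i _ => e i, Finset.sum_add_distrib, smul_add]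
    congr 1
    rw [Finset.sum_const, Finset.card_univ, Fintype.card_fin, ← Nat.cast_smul_eq_nsmul ℝ, smul_smul,
      one_div, inv_mul_cancel₀ hB', one_smul]

lemma isNoise_batch [IsProbabilityMeasure P] [IsProbabilityMeasure ν] (hB : 0 < B)
    (hA : ∀ i j, Measurable fun e => A e i j) (hb : Measurable b)
    (hsymm : ∀ e, (A e).IsSymm) (hf : ∀ e, f e = quadLoss (A e) (b e) c)
    (hxs : IsMinOn (popLoss ν f) Set.univ xs)
    (hgrad : ∫⁻ e, ‖gradient (f e) xs‖ₑ ^ 2 ∂ν ≤ ENNReal.ofReal (σ ^ 2))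
    (hLip : ∫⁻ e, gradLip (f e) xs ^ 2 ∂ν ≤ ENNReal.ofReal (Lf ^ 2))
    {ξ : ℕ → Fin B → Ω → E} (hξ : ∀ t i, Measurable (ξ t i)) (hlaw : ∀ t i, P.map (ξ t i) = ν)
    (hindep : iIndepFun (fun p : ℕ × Fin B => ξ p.1 p.2) P) :
    IsNoise P (fun t ω i => ξ (t + 1) i ω) (batchLin ν A) (batchGradNoise A b xs)
      (Lf ^ 2 / B) (σ ^ 2 / B) := by
  have hAL := fun v => memLp_toEuclideanCLM hA hsymm hf hLip v
  obtain ⟨hz, hzσ⟩ := memLp_gradNoise hA hb hsymm hf hgrad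
  have hAi : ∀ v, Integrable (fun e => toEuclideanCLM (𝕜 := ℝ) (A e) v) ν := fun v =>
    (hAL v).1.integrable (by norm_num)
  have hz0 := integral_gradNoise_eq_zero hsymm hf hAi (hz.integrable (by norm_num)) hxs
  have hind : ∀ t, ∀ i j : Fin B, i ≠ j → IndepFun (ξ (t + 1) i) (ξ (t + 1) j) P := by
    intro t i j hij
    exact hindep.indepFun (i := (t + 1, i)) (j := (t + 1, j)) (by simpa using hij)
  have hlin := fun t v => batchMean_moments hB (fun i => hξ (t + 1) i) (fun i => hlaw (t + 1) i)
    (hind t) (g := fun e => toEuclideanCLM (𝕜 := ℝ) (A e) v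
      - toEuclideanCLM (𝕜 := ℝ) (hessian ν A) v)
    ((measurable_toEuclideanCLM_apply hA v).sub_const _) ((hAL v).1.sub (memLp_const _))
    (by rw [integral_sub (hAi v) (integrable_const _), integral_toEuclideanCLM hAi]; simp)
  have hadd := fun t => batchMean_moments hB (fun i => hξ (t + 1) i) (fun i => hlaw (t + 1) i)
    (hind t) (measurable_gradNoise hA hb) hz hz0
  constructor
  · exact fun t => measurable_pi_lambda _ fun i => hξ _ _
  · intro t
    have h := indep_iSup_of_disjoint (S := {p : ℕ × Fin B | p.1 = t + 1})
      (T := {p : ℕ × Fin B | p.1 < t + 1}) (fun p => (hξ p.1 p.2).comap_le) hindep.iIndep (by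
        rw [Set.disjoint_left]
        intro p hp hp'
        simp only [Set.mem_ofPred_eq] at hp hp'
        omega)
    have hcomap : ∀ s, MeasurableSpace.comap (fun ω i => ξ (s + 1) i ω)
        (inferInstance : MeasurableSpace (Fin B → E)) =
        ⨆ i, MeasurableSpace.comap (ξ (s + 1) i) inferInstance := by
      intro s
      simp only [MeasurableSpace.pi, MeasurableSpace.comap_iSup, MeasurableSpace.comap_comp]
      rfl
    refine indep_of_indep_of_le_left (indep_of_indep_of_le_right h ?_) ?_
    · refine iSup₂_le fun s hs => ?_
      rw [hcomap]
      exact iSup_le fun i => le_iSup₂ (f := fun (p : ℕ × Fin B)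
        (_ : p ∈ {p : ℕ × Fin B | p.1 < t + 1}) =>
          MeasurableSpace.comap (ξ p.1 p.2) inferInstance) (s + 1, i) (by
            simpa using hs)
    · rw [hcomap]
      exact iSup_le fun i => le_iSup₂ (f := fun (p : ℕ × Fin B)
        (_ : p ∈ {p : ℕ × Fin B | p.1 = t + 1}) =>
          MeasurableSpace.comap (ξ p.1 p.2) inferInstance) (t + 1, i) rfl
  · intro v
    simp only [batchLin_apply]
    have : Measurable fun η : Fin B → E => ∑ i, (toEuclideanCLM (𝕜 := ℝ) (A (η i)) v
        - toEuclideanCLM (𝕜 := ℝ) (hessian ν A) v) :=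
      Finset.measurable_fun_sum _ fun i _ => ((measurable_toEuclideanCLM_apply hA v).comp
        (measurable_pi_apply i)).sub_const _
    exact this.const_smul (1 / (B : ℝ))
  · have : Measurable fun η : Fin B → E => ∑ i, gradNoise A b xs (η i) :=
      Finset.measurable_fun_sum _ fun i _ => (measurable_gradNoise hA hb).comp
        (measurable_pi_apply i)
    exact this.const_smul (1 / (B : ℝ))
  · intro t v
    simp only [batchLin_apply]
    exact (hlin t v).1
  · exact fun t => (hadd t).1
  · intro t v v'
    simp only [batchLin_apply]
    exact (hlin t v').2.1 v
  · exact fun t v => (hadd t).2.1 v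
  · intro t v
    simp only [batchLin_apply]
    refine (hlin t v).2.2.trans ?_
    have h1 := integral_norm_sub_mean_sq_le (hAL v).1
    rw [integral_toEuclideanCLM hAi] at h1
    rw [div_mul_eq_mul_div]
    gcongr
    exact h1.trans (hAL v).2
  · exact fun t => (hadd t).2.2.trans (by gcongr)
  · positivity
  · positivity

end Batch

/-! ### Characteristic functions -/

section CharFun

variable {d : ℕ} {E : Type*} [MeasurableSpace E] {ν : Measure E}
  {Ω : Type*} [MeasurableSpace Ω] {P : Measure Ω}

/-- The classical central limit theorem at the level of characteristic functions, along an arbitrary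
sequence of sample sizes and without normalization of the variance. -/
lemma tendsto_charFun_pow [IsProbabilityMeasure ν] {Z : E → ℝ} (hZ : MemLp Z 2 ν)
    (h₀ : ∫ e, Z e ∂ν = 0) {m : ℕ → ℕ} (hm : Tendsto m atTop atTop) :
    Tendsto (fun k => charFun (ν.map Z) (√(m k : ℝ))⁻¹ ^ m k) atTop
      (𝓝 (Complex.exp (-((∫ e, Z e ^ 2 ∂ν : ℝ) : ℂ) / 2))) := by
  set V := ∫ e, Z e ^ 2 ∂ν with hV
  have hV0 : 0 ≤ V := integral_nonneg fun _ => sq_nonneg _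
  rcases hV0.eq_or_lt with h | h
  · -- a degenerate variable vanishes almost surely
    have hae : Z =ᵐ[ν] fun _ => 0 := by
      have := (integral_eq_zero_iff_of_nonneg (fun _ => sq_nonneg _) hZ.integrable_sq).1
        (hV.symm.trans h.symm)
      filter_upwards [this] with e he
      simpa using he
    rw [Measure.map_congr hae, ← h]
    simp [charFun_dirac]
  · set s := √V with hs
    have hs0 : 0 < s := Real.sqrt_pos.2 h
    have hs2 : s ^ 2 = V := Real.sq_sqrt hV0
    have h1 := (tendsto_charFun_inv_sqrt_mul_pow (P := ν) (X := fun e => s⁻¹ * Z e)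
      (hZ.1.aemeasurable.const_mul _) (by rw [integral_const_mul, h₀, mul_zero])
      (by
        simp only [Pi.pow_apply, mul_pow]
        rw [integral_const_mul, ← hV, ← hs2]
        field_simp) s).comp hm
    have e : ∀ r : ℝ, charFun (ν.map fun e => s⁻¹ * Z e) (r * s) = charFun (ν.map Z) r := by
      intro r
      rw [charFun_map_mul_comp hZ.1.aemeasurable]
      congr 1
      field_simp
    have e2 : (-(s : ℂ) ^ 2 / 2) = -(V : ℂ) / 2 := by rw [← hs2]; push_cast; ring
    rw [e2] at h1
    refine h1.congr fun k => ?_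
    simp only [Function.comp_apply, e]

lemma integral_exp_sum_eq_charFun_pow [IsProbabilityMeasure P] {ι : Type*} {ζ : ι → Ω → E}
    (hζ : ∀ p, Measurable (ζ p)) (hlaw : ∀ p, P.map (ζ p) = ν) (hind : iIndepFun ζ P)
    {Z : E → ℝ} (hZ : Measurable Z) (F : Finset ι) (r : ℝ) :
    ∫ ω, Complex.exp (((r * ∑ p ∈ F, Z (ζ p ω) : ℝ) : ℂ) * Complex.I) ∂P =
      charFun (ν.map Z) r ^ F.card := by
  have hm : Measurable fun ω => ∑ p ∈ F, Z (ζ p ω) :=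
    Finset.measurable_fun_sum _ fun p _ => hZ.comp (hζ p)
  have h1 := ((hind.comp (fun _ => Z) fun _ => hZ).restrict F).charFun_map_fun_finsetSum_eq_prod
    (fun p _ => (hZ.comp (hζ p)).aemeasurable)
  have h2 := congrFun h1 r
  have h3 : ∀ p, P.map (Z ∘ ζ p) = ν.map Z := fun p => by
    rw [← Measure.map_map hZ (hζ p), hlaw]
  simp only [h3, Finset.prod_const, Pi.pow_apply, Function.comp_apply] at h2
  rw [← h2, charFun_apply_real, integral_map hm.aemeasurable
    (by fun_prop)]
  simp

lemma norm_integral_exp_add_sub_le [IsProbabilityMeasure P] {x r : Ω → ℝ} (hx : AEMeasurable x P)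
    (hr : Integrable r P) :
    ‖∫ ω, Complex.exp (((x ω + r ω : ℝ) : ℂ) * Complex.I) ∂P
      - ∫ ω, Complex.exp ((x ω : ℂ) * Complex.I) ∂P‖ ≤ ∫ ω, |r ω| ∂P := by
  have hint : ∀ g : Ω → ℝ, AEMeasurable g P →
      Integrable (fun ω => Complex.exp ((g ω : ℂ) * Complex.I)) P := fun g hg => by
    refine Integrable.of_bound (C := 1) (by fun_prop) (Eventually.of_forall fun ω => ?_)
    rw [Complex.norm_exp_ofReal_mul_I]
  rw [← integral_sub (hint (fun ω => x ω + r ω) (hx.add hr.1.aemeasurable)) (hint _ hx)]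
  refine (norm_integral_le_integral_norm _).trans (integral_mono_of_nonneg
    (Eventually.of_forall fun ω => norm_nonneg _) hr.abs (Eventually.of_forall fun ω => ?_))
  have e : Complex.exp (((x ω + r ω : ℝ) : ℂ) * Complex.I) - Complex.exp ((x ω : ℂ) * Complex.I) =
      Complex.exp ((x ω : ℂ) * Complex.I) * (Complex.exp (Complex.I * (r ω : ℂ)) - 1) := by
    push_cast
    rw [add_mul, Complex.exp_add, mul_comm Complex.I]
    ring
  dsimp only
  rw [e, norm_mul, Complex.norm_exp_ofReal_mul_I, one_mul]
  exact Real.norm_exp_I_mul_ofReal_sub_one_le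

lemma integral_abs_inner_le [IsProbabilityMeasure P] {R : Ω → EuclideanSpace ℝ (Fin d)}
    (hR : MemLp R 2 P) (w : EuclideanSpace ℝ (Fin d)) :
    ∫ ω, |inner ℝ (R ω) w| ∂P ≤ ‖w‖ * √(∫ ω, ‖R ω‖ ^ 2 ∂P) := by
  have hRi : Integrable (fun ω => ‖R ω‖) P := hR.norm.integrable (by norm_num)
  have h1 : ∫ ω, |inner ℝ (R ω) w| ∂P ≤ ∫ ω, ‖w‖ * ‖R ω‖ ∂P := by
    refine integral_mono_of_nonneg (Eventually.of_forall fun _ => abs_nonneg _)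
      (hRi.const_mul _) (Eventually.of_forall fun ω => ?_)
    exact (abs_real_inner_le_norm _ _).trans_eq (mul_comm _ _)
  refine h1.trans ?_
  rw [integral_const_mul]
  refine mul_le_mul_of_nonneg_left (Real.le_sqrt_of_sq_le ?_) (norm_nonneg _)
  have h2 := variance_nonneg (fun ω => ‖R ω‖) P
  rw [variance_eq_sub hR.norm] at h2
  simpa using h2

end CharFun

/-! ### A single run -/

section SingleRun

/-- The normalized average of the iterates after the burn-in. -/
noncomputable def scaledAverage {d : ℕ} {E Ω : Type*} {B : ℕ}
    (f : E → EuclideanSpace ℝ (Fin d) → ℝ) (γ α σ : ℝ) (n₀ n : ℕ)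
    (xs x₁ : EuclideanSpace ℝ (Fin d)) (ξ : ℕ → Fin B → Ω → E) (ω : Ω) :
    EuclideanSpace ℝ (Fin d) :=
  (√(B : ℝ) / σ / √((n : ℝ) - (n₀ : ℝ))) •
    ∑ t ∈ Finset.Icc (n₀ + 1) n, ((sgdm f γ α (fun t i => ξ t i ω) x₁ t).2 - xs)

lemma scaledAverage_eq {d : ℕ} {E Ω : Type*} {B : ℕ}
    (f : E → EuclideanSpace ℝ (Fin d) → ℝ) (γ α σ : ℝ) (n₀ n : ℕ)
    (xs x₁ : EuclideanSpace ℝ (Fin d)) (ξ : ℕ → Fin B → Ω → E) (ω : Ω) :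
    scaledAverage f γ α σ n₀ n xs x₁ ξ ω = (√(B : ℝ) / σ / √((n : ℝ) - (n₀ : ℝ))) •
      ∑ s ∈ Finset.Ico n₀ n, ((sgdm f γ α (fun t i => ξ t i ω) x₁ (s + 1)).2 - xs) := by
  rw [scaledAverage, Finset.sum_Ico_add'
    (fun t => (sgdm f γ α (fun t i => ξ t i ω) x₁ t).2 - xs) n₀ n 1]
  congr 2

variable {d : ℕ} {E : Type*} [MeasurableSpace E] {ν : Measure E}
  {Ω : Type*} [MeasurableSpace Ω] {P : Measure Ω} {B : ℕ}
  {A : E → Matrix (Fin d) (Fin d) ℝ} {b : E → EuclideanSpace ℝ (Fin d)} {c : ℝ}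
  {f : E → EuclideanSpace ℝ (Fin d) → ℝ} {xs : EuclideanSpace ℝ (Fin d)} {σ Lf : ℝ}
  {S : Matrix (Fin d) (Fin d) ℝ}

lemma mul_inv_of_minEig_pos (hμ : 0 < minEig S) : S * S⁻¹ = 1 := by
  have h0 : (0 : ℝ) ∉ spectrum ℝ S := fun h => absurd (minEig_le h) (not_le.2 hμ)
  rw [spectrum.zero_notMem_iff, Matrix.isUnit_iff_isUnit_det] at h0
  exact Matrix.mul_nonsing_inv S h0

/-- For a single run, the characteristic function of the normalized average is close to that of a
normalized sum of `(n - n₀) B` independent copies of `-σ⁻¹ ⟪A_ξ x* - b_ξ, S⁻¹ v⟫`. -/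
lemma norm_charFun_scaledAverage_sub_le [IsProbabilityMeasure P] [IsProbabilityMeasure ν]
    (hB : 0 < B) (hA : ∀ i j, Measurable fun e => A e i j) (hb : Measurable b)
    (hsymm : ∀ e, (A e).IsSymm) (hf : ∀ e, f e = quadLoss (A e) (b e) c)
    (hxs : IsMinOn (popLoss ν f) Set.univ xs) (hS : S = hessian ν A) (hμ : 0 < minEig S)
    (hσ : 0 < σ)
    (hgrad : ∫⁻ e, ‖gradient (f e) xs‖ₑ ^ 2 ∂ν ≤ ENNReal.ofReal (σ ^ 2))
    (hLip : ∫⁻ e, gradLip (f e) xs ^ 2 ∂ν ≤ ENNReal.ofReal (Lf ^ 2))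
    {x₁ : EuclideanSpace ℝ (Fin d)} {γ α C : ℝ} {n n₀ : ℕ}
    (hγ₀ : 0 ≤ γ) (hγ₁ : γ < 1) (hα : 0 < α) (hΔ : 0 < minDiscr S γ α)
    (hM : constM S γ α ≤ C) (hgap : α ≤ C * (1 - specRad S γ α))
    (hrate : constM S γ α ^ 2 * α ^ 2 * Lf ^ 2 ≤ B * (1 - specRad S γ α))
    (hn₀ : specRad S γ α ^ (2 * n₀) ≤ (B : ℝ)⁻¹ * (1 - specRad S γ α)) (hn : n₀ < n)
    {ξ : ℕ → Fin B → Ω → E} (hξ : ∀ t i, Measurable (ξ t i)) (hlaw : ∀ t i, P.map (ξ t i) = ν)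
    (hindep : iIndepFun (fun p : ℕ × Fin B => ξ p.1 p.2) P) :
    Measurable (scaledAverage f γ α σ n₀ n xs x₁ ξ) ∧ ∀ v,
    ‖charFun (P.map (scaledAverage f γ α σ n₀ n xs x₁ ξ)) v
      - charFun (ν.map fun e => -(σ⁻¹ * inner ℝ (gradNoise A b xs e)
          (toEuclideanCLM (𝕜 := ℝ) S⁻¹ v))) (√(((n - n₀) * B : ℕ) : ℝ))⁻¹ ^ ((n - n₀) * B)‖ ≤
    ‖toEuclideanCLM (𝕜 := ℝ) S⁻¹ v‖ * √(5 * iterConst (maxEig S) C Lf σ ‖x₁ - xs‖ / σ ^ 2 *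
      (Lf ^ 2 * (α / B) + 4 / (((n : ℝ) - n₀) * α))) := by
  have hB' : (0 : ℝ) < B := by exact_mod_cast hB
  have hB1 : (1 : ℝ) ≤ B := by exact_mod_cast hB
  have hsymmS : S.IsSymm := hS ▸ isSymm_hessian hsymm
  have hherm : S.IsHermitian := by simpa [Matrix.IsHermitian] using hsymmS.eq
  have hN := isNoise_batch hB hA hb hsymm hf hxs hgrad hLip hξ hlaw hindep
  have hY := isMomentum_sgdm (ν := ν) (xs := xs) hB hsymm hf γ α x₁ ξ
  rw [← hS] at hY
  have hbd := hY.integral_norm_sq_le_of_burnIn hN hB1 hherm hμ hγ₀ hγ₁ hα hΔ hM hgap hrate hn₀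
  obtain ⟨hRmem, hRle⟩ := hY.integral_remainder_le hN hB' hγ₀ hγ₁ hα hn.le
    (fun t ht => (hbd t ht).1) (fun t ht => (hbd t ht).2)
  have hym := fun t => (hY.measurable hN t).2.mono (past_le hN.measurable_sample t) le_rfl
  set K := iterConst (maxEig S) C Lf σ ‖x₁ - xs‖ with hK
  set y : ℕ → Ω → EuclideanSpace ℝ (Fin d) :=
    fun t ω => (sgdm f γ α (fun t i => ξ t i ω) x₁ (t + 1)).2 - xs with hy
  set H := toEuclideanCLM (𝕜 := ℝ) S with hH
  set u : ℕ → Ω → EuclideanSpace ℝ (Fin d) :=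
    fun s ω => batchGradNoise A b xs (fun i : Fin B => ξ (s + 1) i ω) with hu
  set R : Ω → EuclideanSpace ℝ (Fin d) :=
    fun ω => H (∑ s ∈ Finset.Ico n₀ n, y s ω) + ∑ s ∈ Finset.Ico n₀ n, u s ω with hR
  have hNpos : (0 : ℝ) < (n : ℝ) - n₀ := sub_pos.2 (by exact_mod_cast hn)
  set a := √(B : ℝ) / σ / √((n : ℝ) - (n₀ : ℝ)) with ha
  have ha0 : 0 ≤ a := by positivity
  have hZm : Measurable (scaledAverage f γ α σ n₀ n xs x₁ ξ) := by
    rw [show scaledAverage f γ α σ n₀ n xs x₁ ξ = fun ω => a • ∑ s ∈ Finset.Ico n₀ n, y s ω from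
      funext fun ω => scaledAverage_eq f γ α σ n₀ n xs x₁ ξ ω]
    have : Measurable fun ω => ∑ s ∈ Finset.Ico n₀ n, y s ω :=
      Finset.measurable_fun_sum _ fun s _ => hym s
    exact this.const_smul a
  refine ⟨hZm, fun v => ?_⟩
  set w := toEuclideanCLM (𝕜 := ℝ) S⁻¹ v with hw
  have hHw : H w = v := by
    rw [hw, hH, ← mul_apply_eq_comp, ← map_mul, mul_inv_of_minEig_pos hμ, map_one]
    rfl
  have hHsymm : ∀ z, inner ℝ z (H w) = inner ℝ (H z) w := fun z => by
    rw [hH, real_inner_comm w, inner_toEuclideanCLM, inner_toEuclideanCLM,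
      Matrix.dotProduct_mulVec, ← Matrix.mulVec_transpose, hsymmS.eq, dotProduct_comm]
  set Z : E → ℝ := fun e => -(σ⁻¹ * inner ℝ (gradNoise A b xs e) w) with hZ
  have hZmeas : Measurable Z := by
    have := measurable_gradNoise (xs := xs) hA hb
    fun_prop
  set F : Finset (ℕ × Fin B) := Finset.Ico n₀ n ×ˢ Finset.univ with hF
  have hcard : F.card = (n - n₀) * B := by simp [hF]
  set r := (√(((n - n₀) * B : ℕ) : ℝ))⁻¹ with hr
  have hcoef : a * (1 / (B : ℝ)) = r * σ⁻¹ := by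
    rw [ha, hr, Nat.cast_mul, Nat.cast_sub hn.le, Real.sqrt_mul hNpos.le]
    have h1 : √(B : ℝ) ^ 2 = B := Real.sq_sqrt hB'.le
    have h2 : 0 < √(B : ℝ) := Real.sqrt_pos.2 hB'
    have h3 : 0 < √((n : ℝ) - n₀) := Real.sqrt_pos.2 hNpos
    field_simp
    exact h1
  -- the inner product with `v` splits into a normalized i.i.d. sum and a remainder
  have hdec : ∀ ω, inner ℝ (scaledAverage f γ α σ n₀ n xs x₁ ξ ω) v =
      r * ∑ p ∈ F, Z (ξ (p.1 + 1) p.2 ω) + inner ℝ (a • R ω) w := by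
    intro ω
    have h1 : H (∑ s ∈ Finset.Ico n₀ n, y s ω) = R ω - ∑ s ∈ Finset.Ico n₀ n, u s ω := by
      simp only [hR, add_sub_cancel_right]
    have h2 : a * inner ℝ (∑ s ∈ Finset.Ico n₀ n, u s ω) w
        = -(r * ∑ p ∈ F, Z (ξ (p.1 + 1) p.2 ω)) := by
      rw [hF, Finset.sum_product, sum_inner, Finset.mul_sum, Finset.mul_sum,
        ← Finset.sum_neg_distrib]
      refine Finset.sum_congr rfl fun s _ => ?_
      simp only [hu, batchGradNoise, hZ]
      rw [real_inner_smul_left, ← mul_assoc, hcoef, sum_inner, Finset.sum_neg_distrib,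
        ← Finset.mul_sum]
      ring
    rw [scaledAverage_eq, real_inner_smul_left, ← hHw, hHsymm, h1, inner_sub_left, mul_sub, h2,
      real_inner_smul_left]
    ring
  have hch : charFun (P.map (scaledAverage f γ α σ n₀ n xs x₁ ξ)) v =
      ∫ ω, Complex.exp (((r * ∑ p ∈ F, Z (ξ (p.1 + 1) p.2 ω) + inner ℝ (a • R ω) w : ℝ) : ℂ)
        * Complex.I) ∂P := by
    rw [charFun_apply, integral_map hZm.aemeasurable (by fun_prop)]
    refine integral_congr_ae (Eventually.of_forall fun ω => ?_)
    dsimp only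
    rw [hdec]
  have hind' : iIndepFun (fun p : ℕ × Fin B => ξ (p.1 + 1) p.2) P :=
    hindep.precomp (g := fun p : ℕ × Fin B => (p.1 + 1, p.2)) (by
      intro p q hpq
      simp only [Prod.mk.injEq, Nat.add_right_cancel_iff] at hpq
      exact Prod.ext hpq.1 hpq.2)
  have hpow := integral_exp_sum_eq_charFun_pow (fun p : ℕ × Fin B => hξ (p.1 + 1) p.2)
    (fun p => hlaw (p.1 + 1) p.2) hind' hZmeas F r
  rw [hcard] at hpow
  rw [hch, ← hpow]
  have haR : MemLp (fun ω => a • R ω) 2 P := hRmem.const_smul a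
  have hxm : Measurable fun ω => r * ∑ p ∈ F, Z (ξ (p.1 + 1) p.2 ω) :=
    (Finset.measurable_fun_sum _ fun p _ => hZmeas.comp (hξ _ _)).const_mul _
  refine (norm_integral_exp_add_sub_le hxm.aemeasurable
    ((haR.inner_const w).integrable (by norm_num))).trans ((integral_abs_inner_le haR w).trans ?_)
  refine mul_le_mul_of_nonneg_left (Real.sqrt_le_sqrt ?_) (norm_nonneg _)
  have h1 : ∀ ω, ‖a • R ω‖ ^ 2 = a ^ 2 * ‖R ω‖ ^ 2 := fun ω => by
    rw [norm_smul, mul_pow, Real.norm_eq_abs, sq_abs]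
  simp_rw [h1]
  rw [integral_const_mul]
  have ha2 : a ^ 2 = B / σ ^ 2 / ((n : ℝ) - n₀) := by
    rw [ha, div_pow, div_pow, Real.sq_sqrt hB'.le, Real.sq_sqrt hNpos.le]
  calc a ^ 2 * ∫ ω, ‖R ω‖ ^ 2 ∂P
      ≤ a ^ 2 * (5 * K * (((n : ℝ) - n₀) * Lf ^ 2 * α / (B : ℝ) ^ 2 + 4 / (α * B))) :=
        mul_le_mul_of_nonneg_left hRle (sq_nonneg a)
    _ = _ := by
      rw [ha2]
      field_simp

end SingleRun

/-! ### The limiting Gaussian law -/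

section Limit

variable {d : ℕ} {E : Type*} [MeasurableSpace E] {ν : Measure E}
  {A : E → Matrix (Fin d) (Fin d) ℝ} {b : E → EuclideanSpace ℝ (Fin d)}
  {xs : EuclideanSpace ℝ (Fin d)} {σ : ℝ} {S : Matrix (Fin d) (Fin d) ℝ}

lemma integral_inner_gradNoise_sq (hz : MemLp (gradNoise A b xs) 2 ν)
    (w : EuclideanSpace ℝ (Fin d)) :
    ∫ e, (σ⁻¹ * inner ℝ (gradNoise A b xs e) w) ^ 2 ∂ν = w.ofLp ⬝ᵥ gram ν A b xs σ *ᵥ w.ofLp := by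
  have hzi : ∀ i, MemLp (fun e => (A e *ᵥ xs.ofLp) i - b e i) 2 ν := fun i =>
    (EuclideanSpace.proj (𝕜 := ℝ) i).comp_memLp' hz
  have hint : ∀ i j, Integrable
      (fun e => ((A e *ᵥ xs.ofLp) i - b e i) * ((A e *ᵥ xs.ofLp) j - b e j)) ν :=
    fun i j => (hzi i).integrable_mul (hzi j)
  have e1 : ∀ e, (σ⁻¹ * inner ℝ (gradNoise A b xs e) w) ^ 2 = ∑ i, ∑ j, w i * ((1 / σ ^ 2) * w j) *
      (((A e *ᵥ xs.ofLp) i - b e i) * ((A e *ᵥ xs.ofLp) j - b e j)) := fun e => by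
    have : inner ℝ (gradNoise A b xs e) w = ∑ i, w i * ((A e *ᵥ xs.ofLp) i - b e i) := by
      simp [gradNoise, PiLp.inner_apply]
    rw [this, mul_pow, sq (∑ i, _), Finset.sum_mul_sum, Finset.mul_sum]
    refine Finset.sum_congr rfl fun i _ => ?_
    rw [Finset.mul_sum]
    refine Finset.sum_congr rfl fun j _ => ?_
    rw [one_div, inv_pow]
    ring
  simp_rw [e1]
  rw [integral_finsetSum _ fun i _ => integrable_finsetSum _ fun j _ => (hint i j).const_mul _]
  rw [dotProduct]
  refine Finset.sum_congr rfl fun i _ => ?_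
  rw [integral_finsetSum _ fun j _ => (hint i j).const_mul _, Matrix.mulVec, dotProduct,
    Finset.mul_sum]
  refine Finset.sum_congr rfl fun j _ => ?_
  rw [integral_const_mul, gram, Matrix.of_apply]
  ring

lemma posSemidef_gram (hz : MemLp (gradNoise A b xs) 2 ν) : (gram ν A b xs σ).PosSemidef := by
  refine Matrix.PosSemidef.of_dotProduct_mulVec_nonneg ?_ fun x => ?_
  · ext i j
    simp only [Matrix.conjTranspose_apply, gram, Matrix.of_apply, star_trivial, mul_comm]
  · have := integral_inner_gradNoise_sq (σ := σ) hz (toLp 2 x)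
    rw [star_trivial, ← WithLp.ofLp_toLp 2 x, ← this]
    exact integral_nonneg fun _ => sq_nonneg _

/-- The characteristic function of `N(0, S⁻¹ Ω S⁻¹)`, as the limit produced by the central limit
theorem for the variable `-σ⁻¹ ⟪A_ξ x* - b_ξ, S⁻¹ v⟫`. -/
lemma charFun_limit (hz : MemLp (gradNoise A b xs) 2 ν) (hsymm : S.IsSymm)
    (v : EuclideanSpace ℝ (Fin d)) :
    charFun (multivariateGaussian 0 (S⁻¹ * gram ν A b xs σ * S⁻¹)) v =
      Complex.exp (-((∫ e, (-(σ⁻¹ * inner ℝ (gradNoise A b xs e)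
        (toEuclideanCLM (𝕜 := ℝ) S⁻¹ v))) ^ 2 ∂ν : ℝ) : ℂ) / 2) := by
  have hinv : S⁻¹ᵀ = S⁻¹ := by rw [Matrix.transpose_nonsing_inv, hsymm.eq]
  have hpsd : (S⁻¹ * gram ν A b xs σ * S⁻¹).PosSemidef := by
    have := (posSemidef_gram (σ := σ) hz).mul_mul_conjTranspose_same S⁻¹
    rwa [Matrix.conjTranspose_eq_transpose_of_trivial, hinv] at this
  rw [charFun_multivariateGaussian hpsd]
  simp_rw [neg_sq]
  rw [integral_inner_gradNoise_sq hz, inner_zero_right, ofLp_toEuclideanCLM]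
  have : v.ofLp ⬝ᵥ (S⁻¹ * gram ν A b xs σ * S⁻¹) *ᵥ v.ofLp =
      (S⁻¹ *ᵥ v.ofLp) ⬝ᵥ gram ν A b xs σ *ᵥ (S⁻¹ *ᵥ v.ofLp) := by
    rw [← Matrix.mulVec_mulVec, ← Matrix.mulVec_mulVec, Matrix.dotProduct_mulVec,
      ← Matrix.mulVec_transpose, hinv]
  rw [this]
  congr 1
  push_cast
  ring

end Limit

/-! ### Convergence along a sequence of runs -/

section Sequence

/-- The rate condition with the factor `16 / (δ λ^{2(1-δ)})` dropped, which is at least `1`. -/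
lemma rate_le {M α Lf B δ l : ℝ} (hB : 0 ≤ B) (hδ₁ : δ ≤ 1) (hl₀ : 0 < l)
    (hl₁ : l < 1) (h : 16 * M ^ 2 * α ^ 2 * Lf ^ 2 ≤ B * δ * l ^ (2 * (1 - δ)) * (1 - l)) :
    M ^ 2 * α ^ 2 * Lf ^ 2 ≤ B * (1 - l) := by
  have h1 : l ^ (2 * (1 - δ)) ≤ 1 := Real.rpow_le_one hl₀.le hl₁.le (by linarith)
  have h2 : 0 ≤ l ^ (2 * (1 - δ)) := (Real.rpow_pos_of_pos hl₀ _).le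
  have h3 : δ * l ^ (2 * (1 - δ)) ≤ 1 := mul_le_one₀ hδ₁ h2 h1
  have h4 : B * (1 - l) * (δ * l ^ (2 * (1 - δ))) ≤ B * (1 - l) :=
    mul_le_of_le_one_right (mul_nonneg hB (by linarith)) h3
  have h5 : 0 ≤ M ^ 2 * α ^ 2 * Lf ^ 2 := by positivity
  linarith

lemma tendsto_atTop_of_mul {α : ℕ → ℝ} {n : ℕ → ℕ} {C : ℝ} (hC : 0 < C) (hα : ∀ k, α k ≤ C)
    (h : Tendsto (fun k => α k * (n k : ℝ)) atTop atTop) : Tendsto n atTop atTop := by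
  rw [← tendsto_natCast_atTop_iff (R := ℝ)]
  have h1 : Tendsto (fun k => C * (n k : ℝ)) atTop atTop :=
    tendsto_atTop_mono (fun k => mul_le_mul_of_nonneg_right (hα k) (Nat.cast_nonneg _)) h
  exact (tendsto_const_mul_atTop_of_pos hC).1 h1

/-- The bound on the distance of the characteristic functions vanishes in the limit. -/
lemma tendsto_remainder_bound {α B : ℕ → ℝ} {n n₀ : ℕ → ℕ} (hα : ∀ k, 0 < α k)
    (hn : ∀ k, 2 * n₀ k ≤ n k) (hαn : Tendsto (fun k => α k * (n k : ℝ)) atTop atTop)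
    (hBα : Tendsto (fun k => B k / α k) atTop atTop) (a K l : ℝ) :
    Tendsto (fun k => a * √(K * (l * (α k / B k) + 4 / (((n k : ℝ) - n₀ k) * α k)))) atTop
      (𝓝 0) := by
  have h1 : Tendsto (fun k => α k / B k) atTop (𝓝 0) :=
    (tendsto_inv_atTop_zero.comp hBα).congr fun k => inv_div _ _
  have h2 : Tendsto (fun k => ((n k : ℝ) - n₀ k) * α k) atTop atTop := by
    refine tendsto_atTop_mono (fun k => ?_) (hαn.const_mul_atTop (by norm_num : (0 : ℝ) < 1 / 2))
    have : 2 * (n₀ k : ℝ) ≤ n k := by exact_mod_cast hn k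
    nlinarith [hα k]
  have h3 := ((((h1.const_mul l).add (h2.const_div_atTop 4)).const_mul K).sqrt).const_mul a
  simpa using h3

variable {d : ℕ} {E : Type*} [MeasurableSpace E] {ν : Measure E} [IsProbabilityMeasure ν]
  {A : E → Matrix (Fin d) (Fin d) ℝ} {b : E → EuclideanSpace ℝ (Fin d)} {c : ℝ}
  {f : E → EuclideanSpace ℝ (Fin d) → ℝ} {xs : EuclideanSpace ℝ (Fin d)} {σ Lf : ℝ}
  {S : Matrix (Fin d) (Fin d) ℝ}

/-- The central limit theorem for the averaged iterates, for samples that are measurable rather than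
almost everywhere measurable. -/
lemma tendstoInDistribution_scaledAverage
    (hA : ∀ i j, Measurable fun e => A e i j) (hb : Measurable b)
    (hsymm : ∀ e, (A e).IsSymm) (hf : ∀ e, f e = quadLoss (A e) (b e) c)
    (hxs : IsMinOn (popLoss ν f) Set.univ xs) (hS : S = hessian ν A) (hμ : 0 < minEig S)
    (hσ : 0 < σ)
    (hgrad : ∫⁻ e, ‖gradient (f e) xs‖ₑ ^ 2 ∂ν ≤ ENNReal.ofReal (σ ^ 2))
    (hLip : ∫⁻ e, gradLip (f e) xs ^ 2 ∂ν ≤ ENNReal.ofReal (Lf ^ 2))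
    {x₁ : EuclideanSpace ℝ (Fin d)} {γ α : ℕ → ℝ} {B n n₀ : ℕ → ℕ} {C : ℝ} (hC : 0 < C)
    (hγ₀ : ∀ k, 0 ≤ γ k) (hγ₁ : ∀ k, γ k < 1) (hα : ∀ k, 0 < α k) (hB : ∀ k, 0 < B k)
    (hαC : ∀ k, α k ≤ C)
    (hΔ : ∀ k, 0 < minDiscr S (γ k) (α k))
    (hrate : ∀ k, constM S (γ k) (α k) ^ 2 * α k ^ 2 * Lf ^ 2 ≤
      B k * (1 - specRad S (γ k) (α k)))
    (hn₀ : ∀ k, specRad S (γ k) (α k) ^ (2 * n₀ k) ≤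
      (B k : ℝ)⁻¹ * (1 - specRad S (γ k) (α k)))
    (hn : ∀ k, 2 * n₀ k ≤ n k) (hM : ∀ k, constM S (γ k) (α k) ≤ C)
    (hgap : ∀ k, α k ≤ C * (1 - specRad S (γ k) (α k)))
    (hαn : Tendsto (fun k => α k * (n k : ℝ)) atTop atTop)
    (hBα : Tendsto (fun k => (B k : ℝ) / α k) atTop atTop)
    {Ω : ℕ → Type*} [∀ k, MeasurableSpace (Ω k)]
    {P : (k : ℕ) → Measure (Ω k)} [∀ k, IsProbabilityMeasure (P k)]
    {ξ : (k : ℕ) → ℕ → Fin (B k) → Ω k → E} (hξ : ∀ k t i, Measurable (ξ k t i))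
    (hlaw : ∀ k t i, (P k).map (ξ k t i) = ν)
    (hindep : ∀ k, iIndepFun (fun p : ℕ × Fin (B k) => ξ k p.1 p.2) (P k)) :
    TendstoInDistribution
      (fun k => scaledAverage f (γ k) (α k) σ (n₀ k) (n k) xs x₁ (ξ k)) atTop
      (id : EuclideanSpace ℝ (Fin d) → EuclideanSpace ℝ (Fin d)) P
      (multivariateGaussian 0 (S⁻¹ * gram ν A b xs σ * S⁻¹)) := by
  have hrun := fun k (hk : n₀ k < n k) => norm_charFun_scaledAverage_sub_le (x₁ := x₁) (hB k) hA hb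
    hsymm hf hxs hS hμ hσ hgrad hLip (hγ₀ k) (hγ₁ k) (hα k) (hΔ k) (hM k) (hgap k) (hrate k)
    (hn₀ k) hk (hξ k) (hlaw k) (hindep k)
  have hmeas : ∀ k, Measurable (scaledAverage f (γ k) (α k) σ (n₀ k) (n k) xs x₁ (ξ k)) := by
    intro k
    by_cases hk : n₀ k < n k
    · exact (hrun k hk).1
    · -- the sum is empty
      have : scaledAverage f (γ k) (α k) σ (n₀ k) (n k) xs x₁ (ξ k) = fun _ => 0 := by
        funext ω
        rw [scaledAverage, Finset.Icc_eq_empty (by omega), Finset.sum_empty, smul_zero]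
      rw [this]
      exact measurable_const
  have hn_top : Tendsto n atTop atTop := tendsto_atTop_of_mul hC hαC hαn
  have hlt : ∀ᶠ k in atTop, n₀ k < n k := by
    filter_upwards [hn_top.eventually_ge_atTop 1] with k hk
    have := hn k
    omega
  have hm : Tendsto (fun k => (n k - n₀ k) * B k) atTop atTop := by
    rw [tendsto_atTop] at hn_top ⊢
    intro N
    filter_upwards [hn_top (2 * N)] with k hk
    have h1 := hn k
    have h2 := hB k
    exact le_trans (by omega) (Nat.le_mul_of_pos_right _ h2)
  have hz := (memLp_gradNoise hA hb hsymm hf hgrad).1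
  have hAi := fun v => (memLp_toEuclideanCLM hA hsymm hf hLip v).1.integrable (by norm_num)
  have hzi := hz.integrable (by norm_num)
  have hz0 := integral_gradNoise_eq_zero hsymm hf hAi hzi hxs
  refine ⟨fun k => (hmeas k).aemeasurable, aemeasurable_id,
    ProbabilityMeasure.tendsto_iff_tendsto_charFun.2 fun v => ?_⟩
  simp only [ProbabilityMeasure.coe_mk, Measure.map_id]
  rw [charFun_limit hz (hS ▸ isSymm_hessian hsymm) v]
  set w := toEuclideanCLM (𝕜 := ℝ) S⁻¹ v with hw
  have hZ : MemLp (fun e => -(σ⁻¹ * inner ℝ (gradNoise A b xs e) w)) 2 ν :=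
    ((hz.inner_const w).const_mul σ⁻¹).neg
  have hZ0 : ∫ e, -(σ⁻¹ * inner ℝ (gradNoise A b xs e) w) ∂ν = 0 := by
    simp_rw [real_inner_comm w]
    rw [integral_neg, integral_const_mul, integral_inner hzi, hz0, inner_zero_right, mul_zero,
      neg_zero]
  have hlim := tendsto_charFun_pow hZ hZ0 hm
  have hdiff := squeeze_zero_norm' (hlt.mono fun k hk => (hrun k hk).2 v)
    (tendsto_remainder_bound hα hn hαn hBα ‖w‖
      (5 * iterConst (maxEig S) C Lf σ ‖x₁ - xs‖ / σ ^ 2) (Lf ^ 2))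
  refine (zero_add (Complex.exp _) ▸ hdiff.add hlim).congr fun k => ?_
  rw [sub_add_cancel]

end Sequence

end AvgSGDM

theorem mainTheorem5 {d : ℕ} {E : Type*} [MeasurableSpace E]
    -- the law of `ξ`, and the quadratic losses `f_ξ(x) = ½ xᵀ A_ξ x - b_ξᵀ x + c`
    (ν : Measure E) [IsProbabilityMeasure ν]
    (A : E → Matrix (Fin d) (Fin d) ℝ) (b : E → EuclideanSpace ℝ (Fin d)) (c : ℝ)
    (hA : ∀ i j, Measurable fun e => A e i j) (hb : Measurable b)
    (hsymm : ∀ e, (A e).IsSymm)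
    (f : E → EuclideanSpace ℝ (Fin d) → ℝ) (hf : ∀ e, f e = AvgSGDM.quadLoss (A e) (b e) c)
    -- the minimizer `x*`
    (xs : EuclideanSpace ℝ (Fin d)) (hxs : IsMinOn (AvgSGDM.popLoss ν f) Set.univ xs)
    -- the Hessian `Σ`, whose smallest eigenvalue is positive
    (S : Matrix (Fin d) (Fin d) ℝ) (hS : S = AvgSGDM.hessian ν A)
    (hμ : 0 < AvgSGDM.minEig S)
    -- moment conditions
    (σ Lf : ℝ) (hσ : 0 < σ)
    (hgrad : ∫⁻ e, ‖gradient (f e) xs‖ₑ ^ 2 ∂ν ≤ ENNReal.ofReal (σ ^ 2))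
    (hLip : ∫⁻ e, AvgSGDM.gradLip (f e) xs ^ 2 ∂ν ≤ ENNReal.ofReal (Lf ^ 2))
    -- the initial point, and the parameters of the `k`-th run of the algorithm
    (x₁ : EuclideanSpace ℝ (Fin d)) (δ : ℝ) (hδ₀ : 0 < δ) (hδ₁ : δ ≤ 1)
    (γ α : ℕ → ℝ) (B n n₀ : ℕ → ℕ)
    (hγ₀ : ∀ k, 0 ≤ γ k) (hγ₁ : ∀ k, γ k < 1) (hα : ∀ k, 0 < α k) (hB : ∀ k, 0 < B k)
    (hstab : ∀ k, α k * AvgSGDM.maxEig S < 2 * (1 + γ k) / (1 - γ k))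
    (hΔ : ∀ k, 0 < AvgSGDM.minDiscr S (γ k) (α k))
    (hrate : ∀ k, 16 * AvgSGDM.constM S (γ k) (α k) ^ 2 * α k ^ 2 * Lf ^ 2 ≤
      B k * δ * AvgSGDM.specRad S (γ k) (α k) ^ (2 * (1 - δ)) *
        (1 - AvgSGDM.specRad S (γ k) (α k)))
    (hn₀ : ∀ k, AvgSGDM.specRad S (γ k) (α k) ^ (2 * n₀ k) ≤
      (B k : ℝ)⁻¹ * (1 - AvgSGDM.specRad S (γ k) (α k)))
    (hn : ∀ k, 2 * n₀ k ≤ n k)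
    -- the constants `M` and `α / (1 - λ)` stay bounded
    (C : ℝ) (hM : ∀ k, AvgSGDM.constM S (γ k) (α k) ≤ C)
    (hgap : ∀ k, α k ≤ C * (1 - AvgSGDM.specRad S (γ k) (α k)))
    -- `α n → ∞` and `B / α → ∞`
    (hαn : Tendsto (fun k => α k * (n k : ℝ)) atTop atTop)
    (hBα : Tendsto (fun k => (B k : ℝ) / α k) atTop atTop)
    -- the i.i.d. samples of the `k`-th run
    {Ω : ℕ → Type*} [∀ k, MeasurableSpace (Ω k)]
    (P : (k : ℕ) → Measure (Ω k)) [∀ k, IsProbabilityMeasure (P k)]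
    (ξ : (k : ℕ) → ℕ → Fin (B k) → Ω k → E)
    (hlaw : ∀ k t i, HasLaw (ξ k t i) ν (P k))
    (hindep : ∀ k, iIndepFun (fun p : ℕ × Fin (B k) => ξ k p.1 p.2) (P k)) :
    TendstoInDistribution
      (fun (k : ℕ) (ω : Ω k) =>
        (Real.sqrt (B k) / σ / Real.sqrt ((n k : ℝ) - (n₀ k : ℝ))) •
          ∑ t ∈ Finset.Icc (n₀ k + 1) (n k),
            ((AvgSGDM.sgdm f (γ k) (α k) (fun t i => ξ k t i ω) x₁ t).2 - xs))
      atTop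
      (id : EuclideanSpace ℝ (Fin d) → EuclideanSpace ℝ (Fin d))
      P
      (multivariateGaussian 0 (S⁻¹ * AvgSGDM.gram ν A b xs σ * S⁻¹)) := by
  -- all hypotheses on a single run are available once `0 < λ < 1`
  obtain ⟨κ, hκ⟩ := AvgSGDM.exists_mem_spectrum hμ
  have hl := fun k => AvgSGDM.impulse_bounds hμ (hγ₀ k) (hγ₁ k) (hα k) (hΔ k) (hM k) (hgap k) hκ rfl
  have hC : 0 < C := by
    have h1 : 0 < C * (1 - AvgSGDM.specRad S (γ 0) (α 0)) := (hα 0).trans_le (hgap 0)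
    exact pos_of_mul_pos_left h1 (by linarith [(hl 0).2.1])
  have hαC : ∀ k, α k ≤ C := fun k =>
    (hgap k).trans (mul_le_of_le_one_right hC.le (by linarith [(hl k).1]))
  -- the samples are replaced by measurable modifications
  have hae : ∀ k t i, AEMeasurable (ξ k t i) (P k) := fun k t i => (hlaw k t i).aemeasurable
  have hmain := AvgSGDM.tendstoInDistribution_scaledAverage (x₁ := x₁) hA hb hsymm hf hxs hS hμ hσ
    hgrad hLip hC hγ₀ hγ₁ hα hB hαC hΔ
    (fun k => AvgSGDM.rate_le (Nat.cast_nonneg _) hδ₁ (hl k).1 (hl k).2.1 (hrate k))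
    hn₀ hn hM hgap hαn hBα (ξ := fun k t i => (hae k t i).mk (ξ k t i))
    (fun k t i => (hae k t i).measurable_mk)
    (fun k t i => (Measure.map_congr (hae k t i).ae_eq_mk.symm).trans (hlaw k t i).map_eq)
    (fun k => (hindep k).congr fun p => (hae k p.1 p.2).ae_eq_mk)
  refine hmain.congr (fun k => ?_) Filter.EventuallyEq.rfl
  have hall : ∀ᵐ ω ∂P k, ∀ t i, ξ k t i ω = (hae k t i).mk (ξ k t i) ω :=
    ae_all_iff.2 fun t => ae_all_iff.2 fun i => (hae k t i).ae_eq_mk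
  filter_upwards [hall] with ω hω
  simp only [AvgSGDM.scaledAverage, hω]
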